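/- **Setting.** Let $\mathcal T\subseteq\mathbb Z$ be a set of rounds containing the offline rounds $-T_0,\dots,-1$ and the online rounds $1,\dots,T$. In round $t$ an agent sees a context $X_t\in\mathcal X$ (the contexts $(X_t)_{t\in\mathcal T}$ are independent, with arbitrary laws), chooses an action $a_t\in[K]=\{1,\dots,K\}$ and receives $R_t^{a_t}$, where $R_t^a=\varphi(X_t,a)^\top\gamma_{0,t}+\epsilon_t$ for a known feature map $\varphi:\mathcal X\times[K]\to\mathbb R^p$ and unknown $\gamma_{0,t}\in\mathbb R^p$. Within each of the two phases (offline, online) the noise $\epsilon_t$ has conditional mean zero and is conditionally $\sigma$-sub-Gaussian given the chosen features and rewards of the earlier rounds of the phase and $\varphi(X_t,a_t)$. For $t\in\mathcal T$ and $a\in[K]$ we have $\|\varphi(X_t,a)\|_2\le L$ almost surely and $\|\gamma_{0,t}\|_2\le M$, and $\gamma_{0,t}$ is constant for $t\in[T]$. There is a non-degenerate invariant subspace decomposition $(\mathcal S^{\mathrm{inv}},\mathcal S^{\mathrm{res}})$ of $\mathbb R^p$, that is: 1. $\mathcal S^{\mathrm{inv}}=(\mathcal S^{\mathrm{res}})^\perp$;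 2. $\operatorname{Cov}(\Pi^{\mathcal S^{\mathrm{inv}}}\varphi(X_t,a),\Pi^{\mathcal S^{\mathrm{res}}}\varphi(X_t,a))=0$ for all $t\in\mathcal T$, $a\in[K]$, where $\Pi^{\mathcal S}$ is the orthogonal projection onto $\mathcal S$; 3. there is $\beta^{\mathrm{inv}}\in\mathcal S^{\mathrm{inv}}$ such that for all $t\in\mathcal T$, $\gamma_{0,t}=\beta^{\mathrm{inv}}+\delta_t^{\mathrm{res}}$ for some $\delta_t^{\mathrm{res}}\in\mathcal S^{\mathrm{res}}$; 4. $\dim\mathcal S^{\mathrm{inv}}<p$, and $\dim\mathcal S^{\mathrm{inv}}$ is maximal among all pairs of subspaces satisfying 1–3. Put $p^{\mathrm{res}}=\dim\mathcal S^{\mathrm{res}}$, and let $U\in\mathbb R^{p\times p^{\mathrm{res}}}$ have columns forming an orthonormal basis of $\mathcal S^{\mathrm{res}}$. **Oracle ISD-linUCB.** The algorithm knows $\mathcal S^{\mathrm{inv}},\mathcal S^{\mathrm{res}},U,\beta^{\mathrm{inv}}$ and has parameters $\lambda>0$, $\eta\in(0,1)$, $\sigma,L,M$. Write $\varphi_\tau=\varphi(X_\tau,a_\tau)$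 and $\|x\|_A^2=x^\top Ax$. For $t=1,\dots,T$ let $$\hat\Sigma_{t-1}=\lambda I_p+\sum_{\tau=1}^{t-1}\varphi_\tau\varphi_\tau^\top,\qquad \hat\delta_t=U(U^\top\hat\Sigma_{t-1}U)^{-1}\sum_{\tau=1}^{t-1}U^\top\varphi_\tau(R_\tau^{a_\tau}-\varphi_\tau^\top\beta^{\mathrm{inv}}),$$ $$\sqrt{\hat\rho_t}=\sigma\sqrt{2\log\tfrac1\eta+p^{\mathrm{res}}\log\Bigl(1+\tfrac{tL^2}{\lambda p^{\mathrm{res}}}\Bigr)}+\sqrt\lambda M,\qquad \hat{\mathcal C}_t=\{\delta\in\mathcal S^{\mathrm{res}}:\|\hat\delta_t-\delta\|^2_{\hat\Sigma_{t-1}}\le\hat\rho_t\},$$ and choose $a_t\in\arg\max_{a\in[K]}\max_{\gamma\in\{\beta^{\mathrm{inv}}\}+\hat{\mathcal C}_t}\varphi(X_t,a)^\top\gamma$. With $a_t^*\in\arg\max_{a\in[K]}\varphi(X_t,a)^\top\gamma_{0,t}$, its regret is $\operatorname{Reg}_T=\mathbb E\bigl[\sum_{t=1}^T(R_t^{a_t^*}-R_t^{a_t})\bigr]$.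 **Theorem.** In this setting, with $\eta=1/T$, the regret of oracle ISD-linUCB is $\tilde O(p^{\mathrm{res}}\sqrt T)$. That is, for all $\sigma\ge0$, $\lambda>0$ and $L,M$ there are $c>0$ and $k,N\in\mathbb N$, depending only on $\sigma,\lambda,L,M$, such that for every instance of the setting with horizon $T\ge N$ the random variable $\sum_{t=1}^T(R_t^{a_t^*}-R_t^{a_t})$ is integrable and $$\operatorname{Reg}_T\le c\,p^{\mathrm{res}}\sqrt T\,(\log T)^k .$$ -/

import Mathlib

open MeasureTheory ProbabilityTheory
open scoped Pointwise Matrix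

universe u v

noncomputable section

namespace ISDBandit

/-- `ℝ^p` with its Euclidean norm and inner product. -/
abbrev Vec (p : ℕ) : Type := EuclideanSpace ℝ (Fin p)

/-- The data of a linear contextual bandit environment with features in `ℝ^p` and actions `[K]`:
the feature map `φ`, the contexts `X t`, the parameters `γ t` and the noise `ε t`.
Rounds are integers: online rounds are positive, offline rounds are negative. -/
structure Bandit (Ω : Type u) (𝒳 : Type v) (p K : ℕ) where
  /-- context-action feature map -/
  φ : 𝒳 → Fin K → Vec p
  /-- contexts -/
  X : ℤ → Ω → 𝒳
  /-- linear parameters -/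
  γ : ℤ → Vec p
  /-- noise variables -/
  ε : ℤ → Ω → ℝ

variable {Ω : Type u} {𝒳 : Type v} {p q K : ℕ}

namespace Bandit

/-- The feature vector `φ(X_t, b)` of action `b` in round `t`. -/
def feat (B : Bandit Ω 𝒳 p K) (t : ℤ) (b : Fin K) (ω : Ω) : Vec p := B.φ (B.X t ω) b

/-- The reward `R_t^b = φ(X_t, b)ᵀ γ_t + ε_t` of action `b` in round `t`. -/
def reward (B : Bandit Ω 𝒳 p K) (t : ℤ) (b : Fin K) (ω : Ω) : ℝ :=
  inner ℝ (B.feat t b ω) (B.γ t) + B.ε t ω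

/-- The σ-algebra generated by the chosen features and received rewards of the rounds
`s, …, t - 1` together with the chosen feature of round `t`, for a phase starting in round `s`. -/
@[reducible] def history (B : Bandit Ω 𝒳 p K) (a : ℤ → Ω → Fin K) (s t : ℤ) : MeasurableSpace Ω :=
  (⨆ τ ∈ Finset.Ico s t,
      MeasurableSpace.comap (fun ω => B.feat τ (a τ ω) ω) inferInstance ⊔
      MeasurableSpace.comap (fun ω => B.reward τ (a τ ω) ω) inferInstance) ⊔
    MeasurableSpace.comap (fun ω => B.feat t (a t ω) ω) inferInstance

end Bandit

/-- `ξ` has conditional mean zero and is `σ`-sub-Gaussian conditionally on `F`: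
`E[exp(s ξ) | F] ≤ exp(s² σ² / 2)` almost surely, for every real `s`. -/
structure IsCondSubGaussian [MeasurableSpace Ω] (μ : Measure Ω) (F : MeasurableSpace Ω)
    (σ : ℝ) (ξ : Ω → ℝ) : Prop where
  integrable : Integrable ξ μ
  mean_zero : μ[ξ | F] =ᵐ[μ] 0
  integrable_exp : ∀ s : ℝ, Integrable (fun ω => Real.exp (s * ξ ω)) μ
  exp_le : ∀ s : ℝ, ∀ᵐ ω ∂μ,
    (μ[fun ω' => Real.exp (s * ξ ω') | F]) ω ≤ Real.exp (s ^ 2 * σ ^ 2 / 2)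

/-- `(Sinv, Sres)` splits `ℝ^p` orthogonally, the projections of the features on the two subspaces
are uncorrelated in all rounds of `𝒯`, and the component of the parameter in `Sinv` is the same
vector in all rounds of `𝒯`. -/
structure IsInvariantSplit [MeasurableSpace Ω] (μ : Measure Ω) (B : Bandit Ω 𝒳 p K) (𝒯 : Set ℤ)
    (Sinv Sres : Submodule ℝ (Vec p)) : Prop where
  orth : Sinv = Sresᗮ
  uncorrelated : ∀ t ∈ 𝒯, ∀ b : Fin K, ∀ i j : Fin p,
    covariance (fun ω => Sinv.starProjection (B.feat t b ω) i)
      (fun ω => Sres.starProjection (B.feat t b ω) j) μ = 0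
  invariant : ∃ β ∈ Sinv, ∀ t ∈ 𝒯, ∃ δ ∈ Sres, B.γ t = β + δ

/-- A non-degenerate invariant subspace decomposition over the rounds in `𝒯`: an invariant split
with `dim Sinv < p` whose invariant subspace has the largest possible dimension. -/
structure IsISD [MeasurableSpace Ω] (μ : Measure Ω) (B : Bandit Ω 𝒳 p K) (𝒯 : Set ℤ)
    (Sinv Sres : Submodule ℝ (Vec p)) : Prop extends IsInvariantSplit μ B 𝒯 Sinv Sres where
  nondegenerate : Module.finrank ℝ Sinv < p
  maximal : ∀ Sinv' Sres' : Submodule ℝ (Vec p), IsInvariantSplit μ B 𝒯 Sinv' Sres' →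
    Module.finrank ℝ Sinv' ≤ Module.finrank ℝ Sinv

/-- `β` is the invariant component of the parameters over the rounds in `𝒯`. -/
def IsInvariantComponent (B : Bandit Ω 𝒳 p K) (𝒯 : Set ℤ) (Sinv Sres : Submodule ℝ (Vec p))
    (β : Vec p) : Prop :=
  β ∈ Sinv ∧ ∀ t ∈ 𝒯, ∃ δ ∈ Sres, B.γ t = β + δ

/-- The hybrid offline/online setting. The environment lives on a set of rounds `𝒯` that contains
the offline rounds `-T₀, …, -1` and the online rounds `1, …, T`; `a t` is the action taken in
round `t`. -/
structure IsHybridSetting [MeasurableSpace Ω] [MeasurableSpace 𝒳] (μ : Measure Ω)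
    (B : Bandit Ω 𝒳 p K) (a : ℤ → Ω → Fin K) (𝒯 : Set ℤ) (T₀ T : ℕ) (σ L M : ℝ)
    (Sinv Sres : Submodule ℝ (Vec p)) : Prop where
  offline_mem : ∀ t ∈ Finset.Icc (-(T₀ : ℤ)) (-1), t ∈ 𝒯
  online_mem : ∀ t ∈ Finset.Icc (1 : ℤ) T, t ∈ 𝒯
  measurable_φ : ∀ b : Fin K, Measurable fun x => B.φ x b
  measurable_X : ∀ t ∈ 𝒯, Measurable (B.X t)
  measurable_ε : ∀ t ∈ 𝒯, Measurable (B.ε t)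
  measurable_a : ∀ t ∈ 𝒯, Measurable (a t)
  indep_X : iIndepFun (fun t : 𝒯 => B.X t) μ
  feat_bound : ∀ t ∈ 𝒯, ∀ b : Fin K, ∀ᵐ ω ∂μ, ‖B.feat t b ω‖ ≤ L
  param_bound : ∀ t ∈ 𝒯, ‖B.γ t‖ ≤ M
  noise_offline : ∀ t ∈ Finset.Icc (-(T₀ : ℤ)) (-1),
    IsCondSubGaussian μ (B.history a (-(T₀ : ℤ)) t) σ (B.ε t)
  noise_online : ∀ t ∈ Finset.Icc (1 : ℤ) T,
    IsCondSubGaussian μ (B.history a 1 t) σ (B.ε t)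
  param_const : ∀ s ∈ Finset.Icc (1 : ℤ) T, ∀ t ∈ Finset.Icc (1 : ℤ) T, B.γ s = B.γ t
  isd : IsISD μ B 𝒯 Sinv Sres

/-- The columns of `U` form an orthonormal basis of the subspace `S`. -/
def IsOrthonormalBasisMatrix (U : Matrix (Fin p) (Fin q) ℝ) (S : Submodule ℝ (Vec p)) : Prop :=
  Uᵀ * U = 1 ∧ Submodule.span ℝ (Set.range fun j : Fin q => WithLp.toLp 2 (U.col j)) = S

/-- The weighted squared norm `‖x‖_A² = xᵀ A x`. -/
def weightedSqNorm (A : Matrix (Fin p) (Fin p) ℝ) (x : Vec p) : ℝ :=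
  WithLp.ofLp x ⬝ᵥ (A *ᵥ WithLp.ofLp x)

/-- The square of `σ √(2 log(1/η) + q log(1 + t L² / (lam q))) + √lam M`, where `q` is the
dimension of the residual subspace. -/
def radius (σ L M lam η : ℝ) (q : ℕ) (t : ℤ) : ℝ :=
  (σ * √(2 * Real.log (1 / η) + q * Real.log (1 + t * L ^ 2 / (lam * q))) + √lam * M) ^ 2

namespace Bandit

/-- The regularized sample covariance `lam I + ∑_{τ = 1}^{t} φ(X_τ, a_τ) φ(X_τ, a_τ)ᵀ`. -/
def covMatrix (B : Bandit Ω 𝒳 p K) (a : ℤ → Ω → Fin K) (lam : ℝ) (t : ℤ) (ω : Ω) :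
    Matrix (Fin p) (Fin p) ℝ :=
  lam • (1 : Matrix (Fin p) (Fin p) ℝ) + ∑ τ ∈ Finset.Icc 1 t,
    Matrix.vecMulVec (WithLp.ofLp (B.feat τ (a τ ω) ω)) (WithLp.ofLp (B.feat τ (a τ ω) ω))

/-- The ridge estimate of the residual component before round `t`, with known invariant component
`β`: `U (Uᵀ Σ_{t-1} U)⁻¹ ∑_{τ = 1}^{t-1} Uᵀ φ_τ (R_τ - φ_τᵀ β)`. -/
def resEstimate (B : Bandit Ω 𝒳 p K) (a : ℤ → Ω → Fin K) (lam : ℝ)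
    (U : Matrix (Fin p) (Fin q) ℝ) (β : Vec p) (t : ℤ) (ω : Ω) : Vec p :=
  WithLp.toLp 2 (U *ᵥ ((Uᵀ * B.covMatrix a lam (t - 1) ω * U)⁻¹ *ᵥ
    ∑ τ ∈ Finset.Icc 1 (t - 1),
      (B.reward τ (a τ ω) ω - inner ℝ (B.feat τ (a τ ω) ω) β) •
        (Uᵀ *ᵥ WithLp.ofLp (B.feat τ (a τ ω) ω))))

/-- The confidence set for the residual component in round `t`. -/
def resConfSet (B : Bandit Ω 𝒳 p K) (a : ℤ → Ω → Fin K) (σ L M lam η : ℝ)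
    (U : Matrix (Fin p) (Fin q) ℝ) (Sres : Submodule ℝ (Vec p)) (β : Vec p) (t : ℤ) (ω : Ω) :
    Set (Vec p) :=
  {δ | δ ∈ Sres ∧ weightedSqNorm (B.covMatrix a lam (t - 1) ω)
    (B.resEstimate a lam U β t ω - δ) ≤ radius σ L M lam η q t}

/-- The actions `a` are chosen in the rounds `1, …, T` by the oracle algorithm: `a_t` maximizes
over all actions `b` the upper confidence bound, which is the maximum of `φ(X_t, b)ᵀ γ` over `γ` in
the sum of `{β}` and the residual confidence set. -/
def IsOracleISDLinUCB (B : Bandit Ω 𝒳 p K) (a : ℤ → Ω → Fin K) (T : ℕ) (σ L M lam η : ℝ)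
    (U : Matrix (Fin p) (Fin q) ℝ) (Sres : Submodule ℝ (Vec p)) (β : Vec p) : Prop :=
  ∀ t ∈ Finset.Icc (1 : ℤ) T, ∀ ω : Ω, ∃ ucb : Fin K → ℝ,
    (∀ b : Fin K, IsGreatest ((fun γ : Vec p => inner ℝ (B.feat t b ω) γ) ''
      ({β} + B.resConfSet a σ L M lam η U Sres β t ω)) (ucb b)) ∧
    ∀ b : Fin K, ucb b ≤ ucb (a t ω)

/-- In each of the rounds `1, …, T`, the action `aStar t` has the largest expected reward given the
context. -/
def IsOptimalPolicy (B : Bandit Ω 𝒳 p K) (aStar : ℤ → Ω → Fin K) (T : ℕ) : Prop :=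
  ∀ t ∈ Finset.Icc (1 : ℤ) T, ∀ ω : Ω, ∀ b : Fin K,
    inner ℝ (B.feat t b ω) (B.γ t) ≤ inner ℝ (B.feat t (aStar t ω) ω) (B.γ t)

/-- The random cumulative reward difference between `aStar` and `a` over the rounds `1, …, T`. -/
def rewardGap (B : Bandit Ω 𝒳 p K) (a aStar : ℤ → Ω → Fin K) (T : ℕ) (ω : Ω) : ℝ :=
  ∑ t ∈ Finset.Icc (1 : ℤ) T, (B.reward t (aStar t ω) ω - B.reward t (a t ω) ω)

/-- The dynamic regret of the actions `a` over the horizon `T`. -/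
def regret [MeasurableSpace Ω] (μ : Measure Ω) (B : Bandit Ω 𝒳 p K)
    (a aStar : ℤ → Ω → Fin K) (T : ℕ) : ℝ :=
  ∫ ω, B.rewardGap a aStar T ω ∂μ

end Bandit

end ISDBandit

end

/-!
The residual coordinates `Uᵀ φ_τ` of the chosen features reduce the algorithm to optimistic linear
regression in dimension `q = dim Sres`: in these coordinates the restricted covariance matrix is the
Gram matrix `V = lam I + ∑ z zᵀ` of the residual features `z`, and the estimate is the ridge
estimate of the residual component of the parameter, because subtracting `φ_τᵀ β` removes the
invariant component exactly. The dimension `p` and the number of actions no longer appear.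

*Confidence.* The error of the ridge estimate in the `V`-norm is at most
`‖∑ ε z‖_{V⁻¹} + √lam M` (`sqrt_ridge_error_le`). The self-normalized noise term is bounded with
probability `1 - η` by the method of mixtures (`measure_selfNormalized_gt_le`): for a fixed
direction `x` the process `exp (∑ (x ⬝ z) ε / σ - (x ⬝ z)² / 2)` has expectation at most one
(`lintegral_exp_sum_le_one`), and its average over a Gaussian `x` is, up to normalization,
`exp (‖∑ ε z‖²_{V⁻¹} / (2 σ²)) / √det V`, to which Markov's inequality applies. The
arithmetic-geometric mean inequality for eigenvalues (`det_gram_le`) turns `log det V` into the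
expression in the radius.

*Optimism.* If the true residual component is in the confidence set, then the regret of the round is
at most `2 √ρ ‖z‖_{V⁻¹}` (`Bandit.inner_feat_sub_le`). The squares of these widths sum to
`O(q log T)` by the elliptical potential lemma (`sum_dotProduct_gram_inv_le`), so that by the
Cauchy-Schwarz inequality the regret on the good events is `O(q √T log T)`.

*Failure.* Each round's confidence set fails with probability at most `η = 1 / T` and then costs at
most `2 L M`, so all failures together cost at most `2 L M` in expectation
(`IsHybridSetting.regret_le`). The failure probabilities are added up over the rounds, so no maximal
inequality over time is needed.
-/

namespace ISDBandit

/-! ### Quadratic forms of positive definite matrices -/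

section QuadraticForm

variable {q : ℕ}

open Matrix

open scoped MatrixOrder Matrix.Norms.L2Operator in
lemma exists_transpose_mul_self_eq {W : Matrix (Fin q) (Fin q) ℝ} (hW : W.PosSemidef) :
    ∃ A : Matrix (Fin q) (Fin q) ℝ, W = Aᵀ * A := by
  obtain ⟨A, hA⟩ := CStarAlgebra.nonneg_iff_eq_star_mul_self.mp hW.nonneg
  exact ⟨A, by rw [hA, star_eq_conjTranspose, conjTranspose_eq_transpose_of_trivial]⟩

lemma dotProduct_transpose_mul_self_mulVec (A : Matrix (Fin q) (Fin q) ℝ) (x y : Fin q → ℝ) :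
    x ⬝ᵥ ((Aᵀ * A) *ᵥ y) = (A *ᵥ x) ⬝ᵥ (A *ᵥ y) := by
  rw [← mulVec_mulVec, dotProduct_mulVec, vecMul_transpose]

lemma dotProduct_mulVec_nonneg' {W : Matrix (Fin q) (Fin q) ℝ} (hW : W.PosSemidef)
    (x : Fin q → ℝ) : 0 ≤ x ⬝ᵥ (W *ᵥ x) := by
  simpa using hW.dotProduct_mulVec_nonneg x

lemma dotProduct_mulVec_comm {W : Matrix (Fin q) (Fin q) ℝ} (hW : W.PosSemidef)
    (x y : Fin q → ℝ) : x ⬝ᵥ (W *ᵥ y) = y ⬝ᵥ (W *ᵥ x) := by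
  obtain ⟨A, rfl⟩ := exists_transpose_mul_self_eq hW
  rw [dotProduct_transpose_mul_self_mulVec, dotProduct_transpose_mul_self_mulVec, dotProduct_comm]

lemma dotProduct_sq_le (x y : Fin q → ℝ) : (x ⬝ᵥ y) ^ 2 ≤ (x ⬝ᵥ x) * (y ⬝ᵥ y) := by
  simpa only [dotProduct, ← pow_two] using Finset.sum_mul_sq_le_sq_mul_sq Finset.univ x y

lemma dotProduct_mulVec_sq_le {W : Matrix (Fin q) (Fin q) ℝ} (hW : W.PosSemidef)
    (x y : Fin q → ℝ) : (x ⬝ᵥ (W *ᵥ y)) ^ 2 ≤ (x ⬝ᵥ (W *ᵥ x)) * (y ⬝ᵥ (W *ᵥ y)) := by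
  obtain ⟨A, rfl⟩ := exists_transpose_mul_self_eq hW
  simp only [dotProduct_transpose_mul_self_mulVec]
  exact dotProduct_sq_le _ _

lemma mulVec_inv_mulVec {V : Matrix (Fin q) (Fin q) ℝ} (hV : V.PosDef) (x : Fin q → ℝ) :
    V *ᵥ (V⁻¹ *ᵥ x) = x := by
  rw [mulVec_mulVec, mul_nonsing_inv _ hV.det_pos.ne'.isUnit, one_mulVec]

lemma inv_mulVec_mulVec {V : Matrix (Fin q) (Fin q) ℝ} (hV : V.PosDef) (x : Fin q → ℝ) :
    V⁻¹ *ᵥ (V *ᵥ x) = x := by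
  rw [mulVec_mulVec, nonsing_inv_mul _ hV.det_pos.ne'.isUnit, one_mulVec]

/-- Cauchy-Schwarz for the pairing of the `V`-norm with the dual `V⁻¹`-norm. -/
lemma abs_dotProduct_le_sqrt_mul_sqrt {V : Matrix (Fin q) (Fin q) ℝ} (hV : V.PosDef)
    (z x : Fin q → ℝ) :
    |z ⬝ᵥ x| ≤ √(z ⬝ᵥ (V⁻¹ *ᵥ z)) * √(x ⬝ᵥ (V *ᵥ x)) := by
  rw [← Real.sqrt_mul (dotProduct_mulVec_nonneg' hV.inv.posSemidef z)]
  refine Real.abs_le_sqrt ?_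
  have h := dotProduct_mulVec_sq_le hV.posSemidef x (V⁻¹ *ᵥ z)
  rw [mulVec_inv_mulVec hV, dotProduct_comm x z, dotProduct_comm (V⁻¹ *ᵥ z) z] at h
  linarith

/-- The triangle inequality for the norm defined by `W`. -/
lemma sqrt_dotProduct_mulVec_sub_le {W : Matrix (Fin q) (Fin q) ℝ} (hW : W.PosSemidef)
    (x y : Fin q → ℝ) :
    √((x - y) ⬝ᵥ (W *ᵥ (x - y))) ≤ √(x ⬝ᵥ (W *ᵥ x)) + √(y ⬝ᵥ (W *ᵥ y)) := by
  rw [Real.sqrt_le_left (by positivity)]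
  have hx := dotProduct_mulVec_nonneg' hW x
  have hy := dotProduct_mulVec_nonneg' hW y
  have h := Real.abs_le_sqrt (dotProduct_mulVec_sq_le hW x y)
  rw [Real.sqrt_mul hx] at h
  have h' := (abs_le.mp h).1
  rw [add_sq, Real.sq_sqrt hx, Real.sq_sqrt hy]
  simp only [mulVec_sub, sub_dotProduct, dotProduct_sub]
  rw [dotProduct_mulVec_comm hW y x]
  linarith

/-- The arithmetic-geometric mean inequality for the eigenvalues of a positive definite matrix. -/
lemma det_le_trace_div_pow (hq : 0 < q) {V : Matrix (Fin q) (Fin q) ℝ} (hV : V.PosDef) :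
    V.det ≤ (V.trace / q) ^ q := by
  have hq' : (0 : ℝ) < q := by exact_mod_cast hq
  have hdet : V.det = ∏ i, hV.isHermitian.eigenvalues i := by
    simpa using hV.isHermitian.det_eq_prod_eigenvalues
  have htr : V.trace = ∑ i, hV.isHermitian.eigenvalues i := by
    simpa using hV.isHermitian.trace_eq_sum_eigenvalues
  have h := Real.geom_mean_le_arith_mean Finset.univ (fun _ => 1) hV.isHermitian.eigenvalues
    (fun _ _ => zero_le_one) (by simpa using hq) fun i _ => (hV.eigenvalues_pos i).le
  simp only [Real.rpow_one, one_mul, ← hdet, ← htr, Finset.sum_const, Finset.card_univ,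
    Fintype.card_fin, nsmul_eq_mul, mul_one] at h
  calc V.det = (V.det ^ (q : ℝ)⁻¹) ^ q :=
        (Real.rpow_inv_natCast_pow hV.det_pos.le hq.ne').symm
    _ ≤ (V.trace / q) ^ q := pow_le_pow_left₀ (Real.rpow_nonneg hV.det_pos.le _) h q

end QuadraticForm

/-! ### Regularized Gram matrices -/

section Gram

variable {q : ℕ}

open Matrix

/-- The regularized Gram matrix `lam I + ∑_{i < n} z i (z i)ᵀ` of a sequence of vectors. -/
noncomputable def gram (lam : ℝ) (z : ℕ → Fin q → ℝ) (n : ℕ) : Matrix (Fin q) (Fin q) ℝ :=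
  lam • (1 : Matrix (Fin q) (Fin q) ℝ) + ∑ i ∈ Finset.range n, vecMulVec (z i) (z i)

lemma gram_zero (lam : ℝ) (z : ℕ → Fin q → ℝ) : gram lam z 0 = lam • 1 := by
  simp [gram]

lemma gram_succ (lam : ℝ) (z : ℕ → Fin q → ℝ) (n : ℕ) :
    gram lam z (n + 1) = gram lam z n + vecMulVec (z n) (z n) := by
  rw [gram, gram, Finset.sum_range_succ, add_assoc]

lemma dotProduct_gram_mulVec (lam : ℝ) (z : ℕ → Fin q → ℝ) (n : ℕ) (x : Fin q → ℝ) :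
    x ⬝ᵥ (gram lam z n *ᵥ x) = lam * (x ⬝ᵥ x) + ∑ i ∈ Finset.range n, (x ⬝ᵥ z i) ^ 2 := by
  induction n with
  | zero => simp [gram_zero, smul_mulVec]
  | succ n ih =>
    rw [gram_succ, add_mulVec, dotProduct_add, ih, Finset.sum_range_succ, ← add_assoc,
      vecMulVec_mulVec, dotProduct_smul, dotProduct_comm (z n) x]
    simp [pow_two]

lemma gram_posDef {lam : ℝ} (hlam : 0 < lam) (z : ℕ → Fin q → ℝ) (n : ℕ) :
    (gram lam z n).PosDef := by
  refine (PosDef.one.smul hlam).add_posSemidef (posSemidef_sum _ fun i _ => ?_)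
  simpa using posSemidef_vecMulVec_self_star (z i)

lemma trace_gram (lam : ℝ) (z : ℕ → Fin q → ℝ) (n : ℕ) :
    (gram lam z n).trace = lam * q + ∑ i ∈ Finset.range n, z i ⬝ᵥ z i := by
  simp [gram, trace_sum, trace_vecMulVec]

lemma det_gram_le (hq : 0 < q) {lam L : ℝ} (hlam : 0 < lam) {z : ℕ → Fin q → ℝ} {n : ℕ}
    (hz : ∀ i < n, z i ⬝ᵥ z i ≤ L ^ 2) :
    (gram lam z n).det ≤ lam ^ q * (1 + n * L ^ 2 / (lam * q)) ^ q := by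
  have hq' : (0 : ℝ) < q := by exact_mod_cast hq
  refine (det_le_trace_div_pow hq (gram_posDef hlam z n)).trans ?_
  rw [← mul_pow]
  have hsum : ∑ i ∈ Finset.range n, z i ⬝ᵥ z i ≤ n * L ^ 2 := by
    simpa using Finset.sum_le_card_nsmul (Finset.range n) _ (L ^ 2)
      fun i hi => hz i (Finset.mem_range.mp hi)
  refine pow_le_pow_left₀ ?_ ?_ q
  · exact div_nonneg (gram_posDef hlam z n).posSemidef.trace_nonneg hq'.le
  · rw [trace_gram, div_le_iff₀ hq']
    have : lam * (1 + n * L ^ 2 / (lam * q)) * q = lam * q + n * L ^ 2 := by field_simp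
    linarith

/-- The matrix determinant lemma for adding one vector to a Gram matrix. -/
lemma det_gram_succ {lam : ℝ} (hlam : 0 < lam) (z : ℕ → Fin q → ℝ) (n : ℕ) :
    (gram lam z (n + 1)).det =
      (gram lam z n).det * (1 + z n ⬝ᵥ ((gram lam z n)⁻¹ *ᵥ z n)) := by
  rw [gram_succ, vecMulVec_eq Unit,
    det_add_replicateCol_mul_replicateRow (gram_posDef hlam z n).det_pos.ne'.isUnit]
  rw [det_unique (_ : Matrix Unit Unit ℝ), Matrix.add_apply, one_apply_eq, ← replicateRow_vecMul,
    replicateRow_mul_replicateCol_apply, dotProduct_mulVec]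

lemma log_det_gram_div_pow {lam : ℝ} (hlam : 0 < lam) (z : ℕ → Fin q → ℝ) (n : ℕ) :
    Real.log ((gram lam z n).det / lam ^ q) =
      ∑ i ∈ Finset.range n, Real.log (1 + z i ⬝ᵥ ((gram lam z i)⁻¹ *ᵥ z i)) := by
  induction n with
  | zero => simp [gram_zero, hlam.ne']
  | succ n ih =>
    have h := dotProduct_mulVec_nonneg' (gram_posDef hlam z n).inv.posSemidef (z n)
    rw [det_gram_succ hlam, Finset.sum_range_succ, ← ih, mul_div_right_comm, Real.log_mul]
    · exact (div_pos (gram_posDef hlam z n).det_pos (by positivity)).ne'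
    · positivity

lemma dotProduct_gram_inv_le {lam : ℝ} (hlam : 0 < lam) (z : ℕ → Fin q → ℝ) (n : ℕ)
    (x : Fin q → ℝ) : x ⬝ᵥ ((gram lam z n)⁻¹ *ᵥ x) ≤ (x ⬝ᵥ x) / lam := by
  have hV := gram_posDef hlam z n
  set y := (gram lam z n)⁻¹ *ᵥ x with hy
  have h1 : x ⬝ᵥ y = lam * (y ⬝ᵥ y) + ∑ i ∈ Finset.range n, (y ⬝ᵥ z i) ^ 2 := by
    rw [← dotProduct_gram_mulVec, hy, mulVec_inv_mulVec hV, dotProduct_comm]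
  have h2 : 0 ≤ ∑ i ∈ Finset.range n, (y ⬝ᵥ z i) ^ 2 := Finset.sum_nonneg fun _ _ => sq_nonneg _
  have h3 := dotProduct_sq_le x y
  have h4 : 0 ≤ x ⬝ᵥ y := dotProduct_mulVec_nonneg' hV.inv.posSemidef x
  have h5 : 0 ≤ x ⬝ᵥ x := by simpa using dotProduct_star_self_nonneg x
  rw [le_div_iff₀ hlam]
  rcases h4.eq_or_lt with h | h
  · rw [← h]; simpa using h5
  · refine le_of_mul_le_mul_left ?_ h
    calc x ⬝ᵥ y * (x ⬝ᵥ y * lam) = lam * (x ⬝ᵥ y) ^ 2 := by ring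
      _ ≤ lam * (x ⬝ᵥ x * (y ⬝ᵥ y)) := by gcongr
      _ = (x ⬝ᵥ x) * (lam * (y ⬝ᵥ y)) := by ring
      _ ≤ (x ⬝ᵥ x) * (x ⬝ᵥ y) := by gcongr; linarith
      _ = x ⬝ᵥ y * x ⬝ᵥ x := by ring

/-- The elliptical potential lemma. -/
lemma sum_dotProduct_gram_inv_le (hq : 0 < q) {lam L : ℝ} (hlam : 0 < lam)
    {z : ℕ → Fin q → ℝ} {n : ℕ} (hz : ∀ i < n, z i ⬝ᵥ z i ≤ L ^ 2) :
    ∑ i ∈ Finset.range n, z i ⬝ᵥ ((gram lam z i)⁻¹ *ᵥ z i) ≤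
      (1 + L ^ 2 / lam) * (q * Real.log (1 + n * L ^ 2 / (lam * q))) := by
  have key : ∀ i ∈ Finset.range n, z i ⬝ᵥ ((gram lam z i)⁻¹ *ᵥ z i) ≤
      (1 + L ^ 2 / lam) * Real.log (1 + z i ⬝ᵥ ((gram lam z i)⁻¹ *ᵥ z i)) := by
    intro i hi
    have hx := dotProduct_mulVec_nonneg' (gram_posDef hlam z i).inv.posSemidef (z i)
    have hx' : z i ⬝ᵥ ((gram lam z i)⁻¹ *ᵥ z i) ≤ L ^ 2 / lam :=
      (dotProduct_gram_inv_le hlam z i (z i)).trans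
        (by gcongr; exact hz i (Finset.mem_range.mp hi))
    set x := z i ⬝ᵥ ((gram lam z i)⁻¹ *ᵥ z i)
    have h1 : (0 : ℝ) < 1 + x := by linarith
    -- `log (1 + x) ≥ x / (1 + x)`
    have h2 := Real.one_sub_inv_le_log_of_pos h1
    calc x = (1 + x) * (1 - (1 + x)⁻¹) := by field_simp; ring
      _ ≤ (1 + x) * Real.log (1 + x) := by gcongr
      _ ≤ (1 + L ^ 2 / lam) * Real.log (1 + x) := by
        gcongr
        exact Real.log_nonneg (by linarith)
  refine (Finset.sum_le_sum key).trans ?_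
  rw [← Finset.mul_sum, ← log_det_gram_div_pow hlam]
  gcongr
  rw [← Real.log_pow]
  refine Real.log_le_log (div_pos (gram_posDef hlam z n).det_pos (by positivity)) ?_
  rw [div_le_iff₀' (by positivity)]
  exact det_gram_le hq hlam hz

end Gram

/-! ### Gaussian integrals -/

section Gaussian

open Matrix

variable {q : ℕ}

/-- The total mass of the unnormalized standard Gaussian density on `ℝ^q`. Its value is not needed,
only that it is positive and finite. -/
noncomputable def gaussMass (q : ℕ) : ENNReal :=
  ∫⁻ x : Fin q → ℝ, ENNReal.ofReal (Real.exp (-(x ⬝ᵥ x) / 2))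

lemma measurable_dotProduct_left (w : Fin q → ℝ) : Measurable fun x : Fin q → ℝ => x ⬝ᵥ w := by
  unfold dotProduct; fun_prop

lemma measurable_dotProduct_self : Measurable fun x : Fin q → ℝ => x ⬝ᵥ x := by
  unfold dotProduct; fun_prop

lemma gaussMass_ne_top : gaussMass q ≠ ⊤ := by
  have h : Integrable (fun x : Fin q → ℝ => ∏ i, Real.exp (-(1 / 2) * x i ^ 2)) :=
    Integrable.fintype_prod (f := fun _ y => Real.exp (-(1 / 2) * y ^ 2))
      fun _ => integrable_exp_neg_mul_sq (by norm_num)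
  refine ne_of_lt (lt_of_le_of_lt (le_of_eq ?_) h.lintegral_lt_top)
  unfold gaussMass
  congr 1 with x
  rw [← Real.exp_sum, ← Finset.mul_sum]
  congr 2
  simp only [dotProduct, ← pow_two]
  ring

lemma gaussMass_ne_zero : gaussMass q ≠ 0 := by
  unfold gaussMass
  rw [← pos_iff_ne_zero, lintegral_pos_iff_support]
  · have : Function.support (fun x : Fin q → ℝ =>
        ENNReal.ofReal (Real.exp (-(x ⬝ᵥ x) / 2))) = Set.univ := by
      ext x; simp [Real.exp_pos]
    rw [this]
    exact isOpen_univ.measure_pos _ Set.univ_nonempty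
  · exact ((measurable_dotProduct_self.neg.div_const 2).exp).ennreal_ofReal

lemma lintegral_exp_neg_quadratic {V : Matrix (Fin q) (Fin q) ℝ} (hV : V.PosDef) :
    ∫⁻ x : Fin q → ℝ, ENNReal.ofReal (Real.exp (-(x ⬝ᵥ (V *ᵥ x)) / 2)) =
      ENNReal.ofReal (√V.det)⁻¹ * gaussMass q := by
  obtain ⟨A, rfl⟩ := exists_transpose_mul_self_eq hV.posSemidef
  have hdet : (Aᵀ * A).det = A.det ^ 2 := by rw [det_mul, det_transpose, pow_two]
  have hA : A.det ≠ 0 := fun h => by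
    have := hV.det_pos
    rw [hdet, h] at this
    norm_num at this
  have hmeas : Measurable (toLin' A : (Fin q → ℝ) → (Fin q → ℝ)) :=
    (LinearMap.continuous_of_finiteDimensional _).measurable
  have h := lintegral_map (μ := volume) (f := fun x : Fin q → ℝ =>
    ENNReal.ofReal (Real.exp (-(x ⬝ᵥ x) / 2)))
    ((measurable_dotProduct_self.neg.div_const 2).exp).ennreal_ofReal hmeas
  rw [Real.map_matrix_volume_pi_eq_smul_volume_pi hA, lintegral_smul_measure] at h
  simp only [dotProduct_transpose_mul_self_mulVec]
  simp only [toLin'_apply] at h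
  rw [← h, hdet, Real.sqrt_sq_eq_abs, abs_inv, smul_eq_mul, gaussMass]

/-- Completing the square in a Gaussian integral with a linear term. -/
lemma lintegral_exp_linear_sub_quadratic {V : Matrix (Fin q) (Fin q) ℝ} (hV : V.PosDef)
    (s : Fin q → ℝ) :
    ∫⁻ x : Fin q → ℝ, ENNReal.ofReal (Real.exp (x ⬝ᵥ s - x ⬝ᵥ (V *ᵥ x) / 2)) =
      ENNReal.ofReal (Real.exp (s ⬝ᵥ (V⁻¹ *ᵥ s) / 2) * (√V.det)⁻¹) * gaussMass q := by
  rw [ENNReal.ofReal_mul (Real.exp_pos _).le, mul_assoc, ← lintegral_exp_neg_quadratic hV,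
    ← lintegral_const_mul' _ _ ENNReal.ofReal_ne_top,
    ← lintegral_add_right_eq_self _ (V⁻¹ *ᵥ s)]
  congr 1 with x
  rw [← ENNReal.ofReal_mul (Real.exp_pos _).le, ← Real.exp_add]
  congr 2
  have h : (V⁻¹ *ᵥ s) ⬝ᵥ (V *ᵥ x) = x ⬝ᵥ s := by
    rw [dotProduct_mulVec_comm hV.posSemidef, mulVec_inv_mulVec hV]
  rw [mulVec_add, mulVec_inv_mulVec hV, add_dotProduct, add_dotProduct, dotProduct_add,
    dotProduct_add, h, dotProduct_comm (V⁻¹ *ᵥ s) s]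
  ring

end Gaussian

/-! ### Exponential supermartingales -/

section SubGaussian

variable {Ω : Type u} {F : MeasurableSpace Ω} [m0 : MeasurableSpace Ω] {μ : Measure Ω} {σ : ℝ}
  {ξ : Ω → ℝ}

lemma IsCondSubGaussian.lintegral_exp_const_mul_le [IsProbabilityMeasure μ] (hF : F ≤ m0)
    (h : IsCondSubGaussian μ F σ ξ) (hξ : Measurable ξ) (s : ℝ) {Y : Ω → ENNReal}
    (hY : Measurable[F] Y) :
    ∫⁻ ω, ENNReal.ofReal (Real.exp (s * ξ ω)) * Y ω ∂μ ≤
      ENNReal.ofReal (Real.exp (s ^ 2 * σ ^ 2 / 2)) * ∫⁻ ω, Y ω ∂μ := by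
  have hexp : Measurable fun ω => ENNReal.ofReal (Real.exp (s * ξ ω)) := by fun_prop
  set ν := μ.withDensity fun ω => ENNReal.ofReal (Real.exp (s * ξ ω)) with hν
  -- compare the measures with densities `exp (s ξ)` and `exp (s² σ² / 2)` on `F`
  have hle : ν.trim hF ≤ ENNReal.ofReal (Real.exp (s ^ 2 * σ ^ 2 / 2)) • μ.trim hF := by
    refine Measure.le_iff.mpr fun A hA => ?_
    rw [Measure.smul_apply, trim_measurableSet_eq hF hA, trim_measurableSet_eq hF hA, hν,
      withDensity_apply _ (hF A hA), smul_eq_mul,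
      ← ofReal_integral_eq_lintegral_ofReal (h.integrable_exp s).integrableOn
        (Filter.Eventually.of_forall fun _ => (Real.exp_pos _).le),
      ← setIntegral_condExp hF (h.integrable_exp s) hA, ← ofReal_measureReal,
      ← ENNReal.ofReal_mul (Real.exp_pos _).le]
    refine ENNReal.ofReal_le_ofReal ?_
    calc ∫ ω in A, (μ[fun ω' => Real.exp (s * ξ ω') | F]) ω ∂μ
        ≤ ∫ _ in A, Real.exp (s ^ 2 * σ ^ 2 / 2) ∂μ :=
          setIntegral_mono_ae integrable_condExp.integrableOn
            (integrable_const _).integrableOn (h.exp_le s)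
      _ = Real.exp (s ^ 2 * σ ^ 2 / 2) * μ.real A := by
          rw [setIntegral_const, smul_eq_mul, mul_comm]
  calc ∫⁻ ω, ENNReal.ofReal (Real.exp (s * ξ ω)) * Y ω ∂μ
      = ∫⁻ ω, Y ω ∂ν.trim hF := by
        rw [lintegral_trim hF hY, hν,
          lintegral_withDensity_eq_lintegral_mul _ hexp (hY.mono hF le_rfl)]
        rfl
    _ ≤ ∫⁻ ω, Y ω ∂(ENNReal.ofReal (Real.exp (s ^ 2 * σ ^ 2 / 2)) • μ.trim hF) :=
        lintegral_mono' hle le_rfl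
    _ = _ := by rw [lintegral_smul_measure, lintegral_trim hF hY, smul_eq_mul]

/-- The sub-Gaussian bound with a predictable coefficient `u` in place of a constant. -/
lemma IsCondSubGaussian.lintegral_exp_mul_le [IsProbabilityMeasure μ] (hF : F ≤ m0)
    (h : IsCondSubGaussian μ F σ ξ) (hξ : Measurable ξ) {u : Ω → ℝ} (hu : Measurable[F] u)
    {Y : Ω → ENNReal} (hY : Measurable[F] Y) :
    ∫⁻ ω, ENNReal.ofReal (Real.exp (u ω * ξ ω - σ ^ 2 * u ω ^ 2 / 2)) * Y ω ∂μ ≤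
      ∫⁻ ω, Y ω ∂μ := by
  have hY0 : Measurable Y := hY.mono hF le_rfl
  -- simple functions take finitely many values, each on a set in `F`
  have simple : ∀ f : @SimpleFunc Ω F ℝ,
      ∫⁻ ω, ENNReal.ofReal (Real.exp (f ω * ξ ω - σ ^ 2 * f ω ^ 2 / 2)) * Y ω ∂μ ≤
        ∫⁻ ω, Y ω ∂μ := by
    intro f
    have hset : ∀ s : ℝ, MeasurableSet[F] (f ⁻¹' {s}) := fun s =>
      @SimpleFunc.measurableSet_fiber _ _ F f s
    have hsplit : ∀ G : ℝ → Ω → ENNReal, ∀ ω, G (f ω) ω * Y ω =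
        ∑ s ∈ @SimpleFunc.range _ _ F f, G s ω * (f ⁻¹' {s}).indicator Y ω := by
      intro G ω
      rw [Finset.sum_eq_single (f ω)]
      · simp
      · intro s _ hs
        rw [Set.indicator_of_notMem (by simpa using hs.symm), mul_zero]
      · intro hω
        exact absurd (@SimpleFunc.mem_range_self _ _ F f ω) hω
    calc ∫⁻ ω, ENNReal.ofReal (Real.exp (f ω * ξ ω - σ ^ 2 * f ω ^ 2 / 2)) * Y ω ∂μ
        = ∑ s ∈ @SimpleFunc.range _ _ F f, ∫⁻ ω,
            ENNReal.ofReal (Real.exp (s * ξ ω - σ ^ 2 * s ^ 2 / 2)) *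
              (f ⁻¹' {s}).indicator Y ω ∂μ := by
          rw [← lintegral_finsetSum]
          · exact lintegral_congr fun ω => hsplit
              (fun s ω => ENNReal.ofReal (Real.exp (s * ξ ω - σ ^ 2 * s ^ 2 / 2))) ω
          · intro s _
            exact Measurable.mul (by fun_prop) (hY0.indicator (hF _ (hset s)))
      _ ≤ ∑ s ∈ @SimpleFunc.range _ _ F f, ∫⁻ ω, (f ⁻¹' {s}).indicator Y ω ∂μ := by
          refine Finset.sum_le_sum fun s _ => ?_
          have hs := h.lintegral_exp_const_mul_le hF hξ s (hY.indicator (hset s))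
          calc ∫⁻ ω, ENNReal.ofReal (Real.exp (s * ξ ω - σ ^ 2 * s ^ 2 / 2)) *
                (f ⁻¹' {s}).indicator Y ω ∂μ
              = ENNReal.ofReal (Real.exp (-(s ^ 2 * σ ^ 2 / 2))) *
                  ∫⁻ ω, ENNReal.ofReal (Real.exp (s * ξ ω)) *
                    (f ⁻¹' {s}).indicator Y ω ∂μ := by
                rw [← lintegral_const_mul' _ _ ENNReal.ofReal_ne_top]
                refine lintegral_congr fun ω => ?_
                rw [← mul_assoc, ← ENNReal.ofReal_mul (Real.exp_pos _).le, ← Real.exp_add]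
                congr 3
                ring
            _ ≤ ENNReal.ofReal (Real.exp (-(s ^ 2 * σ ^ 2 / 2))) *
                  (ENNReal.ofReal (Real.exp (s ^ 2 * σ ^ 2 / 2)) *
                    ∫⁻ ω, (f ⁻¹' {s}).indicator Y ω ∂μ) := by gcongr
            _ = ∫⁻ ω, (f ⁻¹' {s}).indicator Y ω ∂μ := by
                rw [← mul_assoc, ← ENNReal.ofReal_mul (Real.exp_pos _).le, ← Real.exp_add]
                simp
      _ = ∫⁻ ω, Y ω ∂μ := by
          rw [← lintegral_finsetSum]
          · refine lintegral_congr fun ω => ?_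
            simpa using (hsplit (fun _ _ => 1) ω).symm
          · exact fun s _ => hY0.indicator (hF _ (hset s))
  have husm : @StronglyMeasurable _ _ _ F u := hu.stronglyMeasurable
  set f : ℕ → @SimpleFunc Ω F ℝ := husm.approx
  have hlim : ∀ ω, Filter.Tendsto
      (fun n => ENNReal.ofReal (Real.exp (f n ω * ξ ω - σ ^ 2 * f n ω ^ 2 / 2)) * Y ω)
      Filter.atTop
      (nhds (ENNReal.ofReal (Real.exp (u ω * ξ ω - σ ^ 2 * u ω ^ 2 / 2)) * Y ω)) := by
    intro ω
    refine ENNReal.Tendsto.mul_const ?_ (Or.inl (by simp [Real.exp_pos]))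
    have hc : Continuous fun s : ℝ => ENNReal.ofReal (Real.exp (s * ξ ω - σ ^ 2 * s ^ 2 / 2)) :=
      ENNReal.continuous_ofReal.comp (by fun_prop)
    exact (hc.tendsto (u ω)).comp (husm.tendsto_approx ω)
  calc ∫⁻ ω, ENNReal.ofReal (Real.exp (u ω * ξ ω - σ ^ 2 * u ω ^ 2 / 2)) * Y ω ∂μ
      = ∫⁻ ω, Filter.liminf (fun n => ENNReal.ofReal
          (Real.exp (f n ω * ξ ω - σ ^ 2 * f n ω ^ 2 / 2)) * Y ω) Filter.atTop ∂μ :=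
        lintegral_congr fun ω => (hlim ω).liminf_eq.symm
    _ ≤ Filter.liminf (fun n => ∫⁻ ω, ENNReal.ofReal
          (Real.exp (f n ω * ξ ω - σ ^ 2 * f n ω ^ 2 / 2)) * Y ω ∂μ) Filter.atTop := by
        refine lintegral_liminf_le fun n => ?_
        have hf : Measurable (f n) := (@SimpleFunc.measurable _ _ F _ (f n)).mono hF le_rfl
        fun_prop
    _ ≤ Filter.liminf (fun _ => ∫⁻ ω, Y ω ∂μ) Filter.atTop :=
        Filter.liminf_le_liminf (Filter.Eventually.of_forall fun n => simple (f n))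
    _ = ∫⁻ ω, Y ω ∂μ := Filter.liminf_const _

/-- With variance proxy zero, equality holds almost surely in `exp ξ ≥ 1 + ξ`. -/
lemma IsCondSubGaussian.ae_eq_zero [IsProbabilityMeasure μ] (hF : F ≤ m0)
    (h : IsCondSubGaussian μ F 0 ξ) : ξ =ᵐ[μ] 0 := by
  have hmean : ∫ ω, ξ ω ∂μ = 0 := by
    rw [← integral_condExp hF, integral_congr_ae h.mean_zero]; simp
  have hexp : ∫ ω, Real.exp (ξ ω) ∂μ ≤ 1 := by
    have h1 := h.exp_le 1
    simp only [one_mul] at h1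
    rw [← integral_condExp hF]
    calc ∫ ω, (μ[fun ω' => Real.exp (ξ ω') | F]) ω ∂μ ≤ ∫ _, (1 : ℝ) ∂μ :=
          integral_mono_ae integrable_condExp (integrable_const _)
            (h1.mono fun ω hω => by simpa using hω)
      _ = 1 := by simp
  have hint : Integrable (fun ω => Real.exp (ξ ω)) μ := by simpa using h.integrable_exp 1
  have hlin : Integrable (fun ω => ξ ω + 1) μ := h.integrable.add (integrable_const _)
  have hint' : Integrable (fun ω => Real.exp (ξ ω) - (ξ ω + 1)) μ := hint.sub hlin
  have hnonneg : 0 ≤ fun ω => Real.exp (ξ ω) - (ξ ω + 1) := fun ω =>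
    sub_nonneg.mpr (Real.add_one_le_exp _)
  have hzero : ∫ ω, (Real.exp (ξ ω) - (ξ ω + 1)) ∂μ = 0 := by
    refine le_antisymm ?_ (integral_nonneg hnonneg)
    rw [integral_sub hint hlin, integral_add h.integrable (integrable_const _), hmean]
    simpa using hexp
  filter_upwards [(integral_eq_zero_iff_of_nonneg hnonneg hint').mp hzero] with ω hω
  by_contra hne
  have := Real.add_one_lt_exp hne
  simp only [Pi.zero_apply] at hω
  linarith

lemma lintegral_exp_sum_le_one [IsProbabilityMeasure μ] {F : ℕ → MeasurableSpace Ω}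
    {e u : ℕ → Ω → ℝ} {n : ℕ}
    (hF : ∀ i < n, F i ≤ m0) (he : ∀ i < n, Measurable (e i))
    (heF : ∀ i < n, ∀ j < i, Measurable[F i] (e j))
    (huF : ∀ i < n, ∀ j ≤ i, Measurable[F i] (u j))
    (hsub : ∀ i < n, IsCondSubGaussian μ (F i) σ (e i)) :
    ∫⁻ ω, ENNReal.ofReal (Real.exp
      (∑ i ∈ Finset.range n, (u i ω * e i ω - σ ^ 2 * u i ω ^ 2 / 2))) ∂μ ≤ 1 := by
  induction n with
  | zero => simp
  | succ n ih =>
    refine le_trans (le_of_eq ?_) ((((hsub n n.lt_succ_self).lintegral_exp_mul_le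
      (hF n n.lt_succ_self) (he n n.lt_succ_self) (huF n n.lt_succ_self n le_rfl)
      (Y := fun ω => ENNReal.ofReal (Real.exp
        (∑ i ∈ Finset.range n, (u i ω * e i ω - σ ^ 2 * u i ω ^ 2 / 2)))) ?_)).trans
      (ih (fun i hi => hF i (by lia)) (fun i hi => he i (by lia)) (fun i hi => heF i (by lia))
        (fun i hi => huF i (by lia)) (fun i hi => hsub i (by lia))))
    · refine lintegral_congr fun ω => ?_
      rw [← ENNReal.ofReal_mul (Real.exp_pos _).le, ← Real.exp_add, Finset.sum_range_succ, add_comm]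
    · refine ENNReal.measurable_ofReal.comp (Real.measurable_exp.comp ?_)
      refine Finset.measurable_fun_sum _ fun i hi => ?_
      have h1 := heF n n.lt_succ_self i (Finset.mem_range.mp hi)
      have h2 := huF n n.lt_succ_self i (Finset.mem_range.mp hi).le
      exact (h2.mul h1).sub (((h2.pow_const 2).const_mul _).div_const 2)

end SubGaussian

/-! ### The self-normalized tail bound -/

section SelfNormalized

open Matrix

variable {Ω : Type u} [m0 : MeasurableSpace Ω] {μ : Measure Ω} {q : ℕ} {σ lam η : ℝ}
  {F : ℕ → MeasurableSpace Ω} {e : ℕ → Ω → ℝ} {z : ℕ → Ω → Fin q → ℝ} {n : ℕ}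

lemma sum_mixture_exponent (hσ : σ ≠ 0) (lam : ℝ) (x : Fin q → ℝ) (e : ℕ → ℝ)
    (z : ℕ → Fin q → ℝ) (n : ℕ) :
    ∑ i ∈ Finset.range n,
        ((x ⬝ᵥ z i) / σ * e i - σ ^ 2 * ((x ⬝ᵥ z i) / σ) ^ 2 / 2) - lam * (x ⬝ᵥ x) / 2 =
      x ⬝ᵥ (σ⁻¹ • ∑ i ∈ Finset.range n, e i • z i) - x ⬝ᵥ (gram lam z n *ᵥ x) / 2 := by
  rw [dotProduct_gram_mulVec, dotProduct_smul, dotProduct_sum, Finset.sum_sub_distrib, smul_eq_mul,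
    Finset.mul_sum, add_div, Finset.sum_div]
  have h1 : ∀ i ∈ Finset.range n, (x ⬝ᵥ z i) / σ * e i = σ⁻¹ * (x ⬝ᵥ (e i • z i)) := by
    intro i _
    rw [dotProduct_smul, smul_eq_mul]; ring
  have h2 : ∀ i ∈ Finset.range n, σ ^ 2 * ((x ⬝ᵥ z i) / σ) ^ 2 / 2 = (x ⬝ᵥ z i) ^ 2 / 2 := by
    intro i _
    field_simp
  rw [Finset.sum_congr rfl h1, Finset.sum_congr rfl h2]
  ring

/-- Averaging the exponential supermartingales over a Gaussian direction `x`: Tonelli's theorem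
turns the bound for fixed `x` into a bound for the mixture. -/
lemma lintegral_mixture_le [IsProbabilityMeasure μ] (hσ : σ ≠ 0) (hlam : 0 < lam)
    (hF : ∀ i < n, F i ≤ m0) (he : ∀ i < n, Measurable (e i))
    (heF : ∀ i < n, ∀ j < i, Measurable[F i] (e j))
    (hzF : ∀ i < n, ∀ j ≤ i, Measurable[F i] (z j))
    (hsub : ∀ i < n, IsCondSubGaussian μ (F i) σ (e i)) :
    ∃ H : Ω → ENNReal, Measurable H ∧
      (∀ ω, H ω = ∫⁻ x : Fin q → ℝ, ENNReal.ofReal (Real.exp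
        (x ⬝ᵥ (σ⁻¹ • ∑ i ∈ Finset.range n, e i ω • z i ω) -
          x ⬝ᵥ (gram lam (fun i => z i ω) n *ᵥ x) / 2))) ∧
      ∫⁻ ω, H ω ∂μ ≤ ENNReal.ofReal (√(lam ^ q))⁻¹ * gaussMass q := by
  have hz : ∀ i < n, Measurable (z i) := fun i hi => (hzF i hi i le_rfl).mono (hF i hi) le_rfl
  set f : Ω → (Fin q → ℝ) → ENNReal := fun ω x => ENNReal.ofReal (Real.exp
    (∑ i ∈ Finset.range n, ((x ⬝ᵥ z i ω) / σ * e i ω - σ ^ 2 * ((x ⬝ᵥ z i ω) / σ) ^ 2 / 2) -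
      lam * (x ⬝ᵥ x) / 2)) with hf
  have hfm : Measurable (Function.uncurry f) := by
    refine ENNReal.measurable_ofReal.comp (Real.measurable_exp.comp (Measurable.sub ?_ ?_))
    · refine Finset.measurable_fun_sum _ fun i hi => ?_
      have h1 := he i (Finset.mem_range.mp hi)
      have h2 := hz i (Finset.mem_range.mp hi)
      simp only [dotProduct]
      fun_prop
    · simp only [dotProduct]
      fun_prop
  refine ⟨fun ω => ∫⁻ x, f ω x, hfm.lintegral_prod_right', fun ω => ?_, ?_⟩
  · refine lintegral_congr fun x => ?_
    rw [hf, ← sum_mixture_exponent hσ lam x (fun i => e i ω) (fun i => z i ω) n]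
  · rw [lintegral_lintegral_swap hfm.aemeasurable]
    have hpd : (lam • (1 : Matrix (Fin q) (Fin q) ℝ)).PosDef := PosDef.one.smul hlam
    have hdet : (lam • (1 : Matrix (Fin q) (Fin q) ℝ)).det = lam ^ q := by simp
    rw [← hdet, ← lintegral_exp_neg_quadratic hpd]
    refine lintegral_mono fun x => ?_
    calc ∫⁻ ω, f ω x ∂μ
        = ENNReal.ofReal (Real.exp (-(lam * (x ⬝ᵥ x)) / 2)) * ∫⁻ ω, ENNReal.ofReal (Real.exp
            (∑ i ∈ Finset.range n, ((x ⬝ᵥ z i ω) / σ * e i ω -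
              σ ^ 2 * ((x ⬝ᵥ z i ω) / σ) ^ 2 / 2))) ∂μ := by
          rw [← lintegral_const_mul' _ _ ENNReal.ofReal_ne_top]
          refine lintegral_congr fun ω => ?_
          rw [← ENNReal.ofReal_mul (Real.exp_pos _).le, ← Real.exp_add, neg_div, neg_add_eq_sub]
      _ ≤ ENNReal.ofReal (Real.exp (-(lam * (x ⬝ᵥ x)) / 2)) * 1 := by
          gcongr
          refine lintegral_exp_sum_le_one (u := fun i ω => (x ⬝ᵥ z i ω) / σ) hF he heF
            (fun i hi j hj => ?_) hsub
          have h := (measurable_dotProduct_left x).comp (hzF i hi j hj)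
          simp only [dotProduct_comm x]
          exact h.div_const σ
      _ = ENNReal.ofReal (Real.exp (-(x ⬝ᵥ ((lam • (1 : Matrix (Fin q) (Fin q) ℝ)) *ᵥ x)) / 2)) := by
          rw [mul_one, smul_mulVec, one_mulVec, dotProduct_smul, smul_eq_mul]

/-- The self-normalized tail bound for vector-valued martingales, at a fixed time `n`, by the
method of mixtures: the mixture over Gaussian directions has expectation at most one, and on the
event in question it exceeds `1 / η`. -/
lemma measure_selfNormalized_gt_le [IsProbabilityMeasure μ] (hσ : 0 ≤ σ) (hlam : 0 < lam)
    (hη : 0 < η)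
    (hF : ∀ i < n, F i ≤ m0) (he : ∀ i < n, Measurable (e i))
    (heF : ∀ i < n, ∀ j < i, Measurable[F i] (e j))
    (hzF : ∀ i < n, ∀ j ≤ i, Measurable[F i] (z j))
    (hsub : ∀ i < n, IsCondSubGaussian μ (F i) σ (e i)) :
    μ {ω | σ ^ 2 * (2 * Real.log (1 / η) +
          Real.log ((gram lam (fun i => z i ω) n).det / lam ^ q)) <
        (∑ i ∈ Finset.range n, e i ω • z i ω) ⬝ᵥ ((gram lam (fun i => z i ω) n)⁻¹ *ᵥ
          (∑ i ∈ Finset.range n, e i ω • z i ω))} ≤ ENNReal.ofReal η := by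
  rcases hσ.eq_or_lt with rfl | hσ
  · -- without noise the martingale vanishes almost surely
    have hzero : ∀ᵐ ω ∂μ, ∀ i ∈ Finset.range n, e i ω = 0 := by
      rw [Filter.eventually_all_finset]
      intro i hi
      have hi := Finset.mem_range.mp hi
      exact (hsub i hi).ae_eq_zero (hF i hi)
    refine le_trans (le_of_eq (measure_mono_null ?_ (ae_iff.mp hzero))) zero_le
    intro ω hω hω0
    have : ∑ i ∈ Finset.range n, e i ω • z i ω = 0 :=
      Finset.sum_eq_zero fun i hi => by rw [hω0 i hi, zero_smul]
    simp [this] at hω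
  obtain ⟨H, hHm, hH, hHint⟩ := lintegral_mixture_le hσ.ne' hlam hF he heF hzF hsub
  have hm0 : gaussMass q ≠ 0 := gaussMass_ne_zero
  have hmt : gaussMass q ≠ ⊤ := gaussMass_ne_top
  have hpow : 0 < √(lam ^ q) := Real.sqrt_pos.mpr (by positivity)
  set c : ENNReal := ENNReal.ofReal (1 / η * (√(lam ^ q))⁻¹) * gaussMass q with hc
  have hc0 : c ≠ 0 := mul_ne_zero (by simp; positivity) hm0
  have hct : c ≠ ⊤ := ENNReal.mul_ne_top ENNReal.ofReal_ne_top hmt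
  refine (measure_mono fun ω hω => ?_).trans ((meas_ge_le_lintegral_div hHm.aemeasurable hc0 hct
    (ε := c)).trans ?_)
  · have hV := gram_posDef hlam (fun i => z i ω) n
    simp only [Set.mem_ofPred_eq] at hω ⊢
    rw [hH, lintegral_exp_linear_sub_quadratic hV, hc]
    refine mul_le_mul' (ENNReal.ofReal_le_ofReal ?_) le_rfl
    set S := ∑ i ∈ Finset.range n, e i ω • z i ω
    set V := gram lam (fun i => z i ω) n
    have hdet := hV.det_pos
    have hlogs : Real.log (1 / η) + Real.log (V.det / lam ^ q) / 2 ≤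
        (σ⁻¹ • S) ⬝ᵥ (V⁻¹ *ᵥ (σ⁻¹ • S)) / 2 := by
      rw [mulVec_smul, smul_dotProduct, dotProduct_smul, smul_eq_mul, smul_eq_mul, ← mul_assoc,
        ← pow_two, inv_pow, inv_mul_eq_div]
      have := (lt_div_iff₀' (by positivity : (0 : ℝ) < σ ^ 2)).mpr hω
      linarith
    have hexp := Real.exp_le_exp.mpr hlogs
    rw [Real.exp_add, Real.exp_log (by positivity), ← Real.log_sqrt (by positivity),
      Real.exp_log (Real.sqrt_pos.mpr (by positivity)), Real.sqrt_div hdet.le] at hexp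
    calc 1 / η * (√(lam ^ q))⁻¹ = 1 / η * (√V.det / √(lam ^ q)) * (√V.det)⁻¹ := by
          have := (Real.sqrt_pos.mpr hdet).ne'
          field_simp
      _ ≤ _ := by gcongr
  · refine ENNReal.div_le_of_le_mul (hHint.trans (le_of_eq ?_))
    rw [hc, ← mul_assoc, ← ENNReal.ofReal_mul hη.le]
    congr 2
    field_simp

end SelfNormalized

/-! ### Ridge regression -/

section Ridge

open Matrix

variable {q : ℕ}

/-- The error of the ridge estimate is a self-normalized noise term plus a regularization bias. -/
lemma sqrt_ridge_error_le {lam : ℝ} (hlam : 0 < lam) (z : ℕ → Fin q → ℝ) (e : ℕ → ℝ)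
    (d : Fin q → ℝ) (n : ℕ) {dhat : Fin q → ℝ}
    (hdhat : dhat = (gram lam z n)⁻¹ *ᵥ ∑ i ∈ Finset.range n, (z i ⬝ᵥ d + e i) • z i) :
    √((dhat - d) ⬝ᵥ (gram lam z n *ᵥ (dhat - d))) ≤
      √((∑ i ∈ Finset.range n, e i • z i) ⬝ᵥ ((gram lam z n)⁻¹ *ᵥ
        ∑ i ∈ Finset.range n, e i • z i)) + √lam * √(d ⬝ᵥ d) := by
  have hV := gram_posDef hlam z n
  set S := ∑ i ∈ Finset.range n, e i • z i with hS
  have hVd : gram lam z n *ᵥ d = lam • d + ∑ i ∈ Finset.range n, (z i ⬝ᵥ d) • z i := by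
    rw [gram, add_mulVec, smul_mulVec, one_mulVec, sum_mulVec]
    congr 1
    refine Finset.sum_congr rfl fun i _ => ?_
    rw [vecMulVec_mulVec]
    simp
  have herr : dhat - d = (gram lam z n)⁻¹ *ᵥ (S - lam • d) := by
    nth_rewrite 1 [← inv_mulVec_mulVec hV d]
    rw [hdhat, ← mulVec_sub, hVd, hS]
    congr 1
    simp only [add_smul, Finset.sum_add_distrib]
    abel
  rw [herr, mulVec_inv_mulVec hV, dotProduct_comm]
  refine (sqrt_dotProduct_mulVec_sub_le hV.inv.posSemidef _ _).trans ?_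
  gcongr
  rw [← Real.sqrt_mul hlam.le]
  refine Real.sqrt_le_sqrt ((dotProduct_gram_inv_le hlam z n _).trans (le_of_eq ?_))
  rw [smul_dotProduct, dotProduct_smul, smul_eq_mul, smul_eq_mul]
  field_simp

/-- If the noise term obeys the self-normalized bound, then the true parameter lies in the
confidence ellipsoid around the ridge estimate. -/
lemma ridge_error_le_radius (hq : 0 < q) {lam σ L M η : ℝ} (hlam : 0 < lam) (hσ : 0 ≤ σ)
    {z : ℕ → Fin q → ℝ} {e : ℕ → ℝ} {d : Fin q → ℝ} {n : ℕ}
    (hz : ∀ i < n, z i ⬝ᵥ z i ≤ L ^ 2) (hd : √(d ⬝ᵥ d) ≤ M)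
    (hgood : (∑ i ∈ Finset.range n, e i • z i) ⬝ᵥ ((gram lam z n)⁻¹ *ᵥ
        ∑ i ∈ Finset.range n, e i • z i) ≤
      σ ^ 2 * (2 * Real.log (1 / η) + Real.log ((gram lam z n).det / lam ^ q)))
    {dhat : Fin q → ℝ}
    (hdhat : dhat = (gram lam z n)⁻¹ *ᵥ ∑ i ∈ Finset.range n, (z i ⬝ᵥ d + e i) • z i) :
    (dhat - d) ⬝ᵥ (gram lam z n *ᵥ (dhat - d)) ≤ radius σ L M lam η q (n + 1) := by
  have hV := gram_posDef hlam z n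
  have hM : 0 ≤ M := (Real.sqrt_nonneg _).trans hd
  have hq' : (0 : ℝ) < q := by exact_mod_cast hq
  rw [radius, ← Real.sqrt_le_left (by positivity)]
  refine (sqrt_ridge_error_le hlam z e d n hdhat).trans ?_
  gcongr
  refine (Real.sqrt_le_sqrt hgood).trans ?_
  rw [Real.sqrt_mul (sq_nonneg σ), Real.sqrt_sq hσ]
  gcongr
  rw [← Real.log_pow]
  refine Real.log_le_log (div_pos hV.det_pos (by positivity)) ?_
  rw [div_le_iff₀' (by positivity)]
  refine (det_gram_le hq hlam hz).trans ?_
  gcongr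
  push_cast
  linarith

end Ridge

/-! ### Reduction to the residual subspace -/

section Reduction

open Matrix

variable {Ω : Type u} {𝒳 : Type v} {p q K : ℕ}

lemma sum_Icc_one_eq_sum_range {E : Type*} [AddCommMonoid E] (f : ℤ → E) (n : ℕ) :
    ∑ τ ∈ Finset.Icc (1 : ℤ) n, f τ = ∑ i ∈ Finset.range n, f (i + 1) := by
  induction n with
  | zero => simp
  | succ n ih =>
    rw [Finset.sum_range_succ, ← ih]
    have h : Finset.Icc (1 : ℤ) ((n + 1 : ℕ) : ℤ) =
        insert ((n : ℤ) + 1) (Finset.Icc (1 : ℤ) n) := by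
      ext x; simp only [Finset.mem_Icc, Finset.mem_insert]; push_cast; lia
    rw [h, Finset.sum_insert (by simp), add_comm]

lemma IsOrthonormalBasisMatrix.range_eq {U : Matrix (Fin p) (Fin q) ℝ} {S : Submodule ℝ (Vec p)}
    (hU : IsOrthonormalBasisMatrix U S) :
    LinearMap.range ((WithLp.linearEquiv 2 ℝ (Fin p → ℝ)).symm.toLinearMap ∘ₗ U.mulVecLin) = S := by
  rw [LinearMap.range_comp, range_mulVecLin, Submodule.map_span, ← Set.range_comp, ← hU.2]
  rfl

lemma IsOrthonormalBasisMatrix.transpose_mulVec_mulVec {U : Matrix (Fin p) (Fin q) ℝ}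
    {S : Submodule ℝ (Vec p)} (hU : IsOrthonormalBasisMatrix U S) (x : Fin q → ℝ) :
    Uᵀ *ᵥ (U *ᵥ x) = x := by
  rw [mulVec_mulVec, hU.1, one_mulVec]

lemma IsOrthonormalBasisMatrix.finrank_eq {U : Matrix (Fin p) (Fin q) ℝ}
    {S : Submodule ℝ (Vec p)} (hU : IsOrthonormalBasisMatrix U S) :
    Module.finrank ℝ S = q := by
  rw [← hU.range_eq, LinearMap.finrank_range_of_inj]
  · simp
  · refine (WithLp.linearEquiv 2 ℝ (Fin p → ℝ)).symm.injective.comp ?_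
    exact Function.LeftInverse.injective (g := fun y => Uᵀ *ᵥ y) hU.transpose_mulVec_mulVec

/-- The coordinates of a vector of `S` with respect to the columns of `U`. -/
lemma IsOrthonormalBasisMatrix.exists_mulVec_eq {U : Matrix (Fin p) (Fin q) ℝ}
    {S : Submodule ℝ (Vec p)} (hU : IsOrthonormalBasisMatrix U S) {δ : Vec p} (hδ : δ ∈ S) :
    ∃ d : Fin q → ℝ, δ = WithLp.toLp 2 (U *ᵥ d) := by
  rw [← hU.range_eq] at hδ
  obtain ⟨d, hd⟩ := hδ
  exact ⟨d, hd.symm⟩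

lemma inner_toLp_mulVec (U : Matrix (Fin p) (Fin q) ℝ) (x : Vec p) (d : Fin q → ℝ) :
    inner ℝ x (WithLp.toLp 2 (U *ᵥ d)) = (Uᵀ *ᵥ WithLp.ofLp x) ⬝ᵥ d := by
  rw [mulVec_transpose, ← dotProduct_mulVec, EuclideanSpace.inner_eq_star_dotProduct,
    dotProduct_comm]
  simp

lemma IsOrthonormalBasisMatrix.norm_toLp_mulVec {U : Matrix (Fin p) (Fin q) ℝ}
    {S : Submodule ℝ (Vec p)} (hU : IsOrthonormalBasisMatrix U S) (d : Fin q → ℝ) :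
    ‖(WithLp.toLp 2 (U *ᵥ d) : Vec p)‖ = √(d ⬝ᵥ d) := by
  rw [norm_eq_sqrt_real_inner, inner_toLp_mulVec, hU.transpose_mulVec_mulVec]

/-- The columns of `U` are orthonormal, so taking coordinates does not increase norms. -/
lemma IsOrthonormalBasisMatrix.dotProduct_transpose_mulVec_self_le
    {U : Matrix (Fin p) (Fin q) ℝ} {S : Submodule ℝ (Vec p)} (hU : IsOrthonormalBasisMatrix U S)
    (x : Vec p) : (Uᵀ *ᵥ WithLp.ofLp x) ⬝ᵥ (Uᵀ *ᵥ WithLp.ofLp x) ≤ ‖x‖ ^ 2 := by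
  set z := Uᵀ *ᵥ WithLp.ofLp x with hz
  have h0 : 0 ≤ z ⬝ᵥ z := by simpa using dotProduct_star_self_nonneg z
  have h : z ⬝ᵥ z ≤ ‖x‖ * √(z ⬝ᵥ z) := by
    rw [← hU.norm_toLp_mulVec z]
    calc z ⬝ᵥ z = inner ℝ x (WithLp.toLp 2 (U *ᵥ z)) := by rw [inner_toLp_mulVec]
      _ ≤ _ := real_inner_le_norm _ _
  have hs := Real.sq_sqrt h0
  nlinarith [sq_nonneg (‖x‖ - √(z ⬝ᵥ z))]

lemma weightedSqNorm_toLp_mulVec (A : Matrix (Fin p) (Fin p) ℝ) (U : Matrix (Fin p) (Fin q) ℝ)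
    (x : Fin q → ℝ) :
    weightedSqNorm A (WithLp.toLp 2 (U *ᵥ x)) = x ⬝ᵥ ((Uᵀ * A * U) *ᵥ x) := by
  rw [weightedSqNorm, ← mulVec_mulVec, ← mulVec_mulVec, dotProduct_mulVec x, vecMul_transpose]

namespace Bandit

/-- The coordinates, with respect to the columns of `U`, of the residual part of the feature chosen
in round `i + 1`. Rounds are indexed from zero here. -/
def resFeat (B : Bandit Ω 𝒳 p K) (a : ℤ → Ω → Fin K) (U : Matrix (Fin p) (Fin q) ℝ) (i : ℕ)
    (ω : Ω) : Fin q → ℝ :=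
  Uᵀ *ᵥ WithLp.ofLp (B.feat (i + 1) (a (i + 1) ω) ω)

/-- In the coordinates given by `U`, the restricted covariance matrix is the Gram matrix of the
residual features. -/
lemma transpose_mul_covMatrix_mul (B : Bandit Ω 𝒳 p K) (a : ℤ → Ω → Fin K) (lam : ℝ)
    {U : Matrix (Fin p) (Fin q) ℝ} (hU : Uᵀ * U = 1) (n : ℕ) (ω : Ω) :
    Uᵀ * B.covMatrix a lam n ω * U = gram lam (fun i => B.resFeat a U i ω) n := by
  rw [covMatrix, gram, sum_Icc_one_eq_sum_range, Matrix.mul_add, Matrix.add_mul, Matrix.mul_smul,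
    Matrix.smul_mul, Matrix.mul_one, hU, Matrix.mul_sum, Matrix.sum_mul]
  congr 1
  refine Finset.sum_congr rfl fun i _ => ?_
  rw [mul_vecMulVec, vecMulVec_mul, ← mulVec_transpose]
  rfl

/-- The estimate of the residual component is the ridge estimate computed from the residual
features, whose regression target is the true residual component `U d`. -/
lemma resEstimate_eq (B : Bandit Ω 𝒳 p K) (a : ℤ → Ω → Fin K) (lam : ℝ)
    {U : Matrix (Fin p) (Fin q) ℝ} (hU : Uᵀ * U = 1) {β : Vec p} {d : Fin q → ℝ} {n : ℕ}
    (hγ : ∀ i < n, B.γ (i + 1) = β + WithLp.toLp 2 (U *ᵥ d)) (ω : Ω) :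
    B.resEstimate a lam U β (n + 1) ω = WithLp.toLp 2 (U *ᵥ
      ((gram lam (fun i => B.resFeat a U i ω) n)⁻¹ *ᵥ ∑ i ∈ Finset.range n,
        (B.resFeat a U i ω ⬝ᵥ d + B.ε (i + 1) ω) • B.resFeat a U i ω)) := by
  rw [resEstimate, add_sub_cancel_right, transpose_mul_covMatrix_mul B a lam hU,
    sum_Icc_one_eq_sum_range]
  refine congrArg (fun s => WithLp.toLp 2 (U *ᵥ (_ *ᵥ s))) (Finset.sum_congr rfl fun i hi => ?_)
  rw [reward, hγ i (Finset.mem_range.mp hi), inner_add_right, inner_toLp_mulVec]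
  congr 1
  simp only [resFeat]
  ring

/-- The optimism argument: if the true residual component lies in the confidence set, then the
suboptimality of the chosen action is at most the width of the confidence set in the direction of
the chosen feature. -/
lemma inner_feat_sub_le (B : Bandit Ω 𝒳 p K) {a : ℤ → Ω → Fin K} {σ L M lam η : ℝ}
    (hlam : 0 < lam) {U : Matrix (Fin p) (Fin q) ℝ} {Sres : Submodule ℝ (Vec p)}
    (hU : IsOrthonormalBasisMatrix U Sres) {β δ : Vec p} {n : ℕ} {ω : Ω}
    (hδ : δ ∈ B.resConfSet a σ L M lam η U Sres β (n + 1) ω)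
    {ucb : Fin K → ℝ}
    (hucb : ∀ b : Fin K, IsGreatest ((fun γ : Vec p => inner ℝ (B.feat (n + 1) b ω) γ) ''
      ({β} + B.resConfSet a σ L M lam η U Sres β (n + 1) ω)) (ucb b))
    (hmax : ∀ b : Fin K, ucb b ≤ ucb (a (n + 1) ω)) (b : Fin K) :
    inner ℝ (B.feat (n + 1) b ω) (β + δ) - inner ℝ (B.feat (n + 1) (a (n + 1) ω) ω) (β + δ) ≤
      2 * √(radius σ L M lam η q (n + 1)) *
        √(B.resFeat a U n ω ⬝ᵥ ((gram lam (fun i => B.resFeat a U i ω) n)⁻¹ *ᵥ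
          B.resFeat a U n ω)) := by
  set V := gram lam (fun i => B.resFeat a U i ω) n with hVdef
  have hV : V.PosDef := gram_posDef hlam _ n
  obtain ⟨γ', hγ', hγ'eq⟩ := (hucb (a (n + 1) ω)).1
  obtain ⟨β', hβ', δ', hδ', rfl⟩ := Set.mem_add.mp hγ'
  rw [Set.mem_singleton_iff] at hβ'
  subst hβ'
  have h1 : inner ℝ (B.feat (n + 1) b ω) (β' + δ) ≤ ucb b :=
    (hucb b).2 ⟨β' + δ, Set.add_mem_add rfl hδ, rfl⟩
  have h2 := hmax b
  simp only at hγ'eq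
  obtain ⟨d, rfl⟩ := hU.exists_mulVec_eq hδ.1
  obtain ⟨d', rfl⟩ := hU.exists_mulVec_eq hδ'.1
  -- the estimate is of the form `U x`, so all distances can be measured by `V`
  obtain ⟨x, hx⟩ : ∃ x, B.resEstimate a lam U β' (n + 1) ω = WithLp.toLp 2 (U *ᵥ x) := ⟨_, rfl⟩
  have hdist : ∀ y : Fin q → ℝ,
      WithLp.toLp 2 (U *ᵥ y) ∈ B.resConfSet a σ L M lam η U Sres β' (n + 1) ω →
      √((x - y) ⬝ᵥ (V *ᵥ (x - y))) ≤ √(radius σ L M lam η q (n + 1)) := by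
    intro y hy
    have := hy.2
    rw [hx, ← WithLp.toLp_sub, ← mulVec_sub, weightedSqNorm_toLp_mulVec, add_sub_cancel_right,
      transpose_mul_covMatrix_mul B a lam hU.1] at this
    exact Real.sqrt_le_sqrt this
  have h3 : inner ℝ (B.feat (n + 1) (a (n + 1) ω) ω) (β' + WithLp.toLp 2 (U *ᵥ d')) -
      inner ℝ (B.feat (n + 1) (a (n + 1) ω) ω) (β' + WithLp.toLp 2 (U *ᵥ d)) =
      B.resFeat a U n ω ⬝ᵥ (d' - d) := by
    rw [inner_add_right, inner_add_right, inner_toLp_mulVec, inner_toLp_mulVec, dotProduct_sub]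
    simp only [resFeat]
    ring
  have h4 : √((d' - d) ⬝ᵥ (V *ᵥ (d' - d))) ≤ 2 * √(radius σ L M lam η q (n + 1)) := by
    have htri := sqrt_dotProduct_mulVec_sub_le hV.posSemidef (x - d) (x - d')
    rw [sub_sub_sub_cancel_left] at htri
    linarith [hdist d hδ, hdist d' hδ']
  have h5 := (le_abs_self _).trans (abs_dotProduct_le_sqrt_mul_sqrt hV (B.resFeat a U n ω) (d' - d))
  have h6 := mul_le_mul_of_nonneg_left h4
    (Real.sqrt_nonneg (B.resFeat a U n ω ⬝ᵥ (V⁻¹ *ᵥ B.resFeat a U n ω)))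
  linarith

end Bandit

end Reduction

/-! ### Measurability and boundedness in the hybrid setting -/

section Setting

open Matrix

variable {Ω : Type u} {𝒳 : Type v} {p q K : ℕ}

lemma measurable_apply_choice {E : Type*} [MeasurableSpace Ω] [MeasurableSpace E] {c : Ω → Fin K}
    (hc : Measurable c) {f : Fin K → Ω → E} (hf : ∀ b, Measurable (f b)) :
    Measurable fun ω => f (c ω) ω :=
  (measurable_from_prod_countable_right (f := fun x : Fin K × Ω => f x.1 x.2) hf).comp
    (hc.prodMk measurable_id)

namespace Bandit

/-- The expected reward lost in round `t`, given the context, by playing `a` instead of `aStar`. -/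
noncomputable def instantRegret (B : Bandit Ω 𝒳 p K) (a aStar : ℤ → Ω → Fin K) (t : ℤ)
    (ω : Ω) : ℝ :=
  inner ℝ (B.feat t (aStar t ω) ω) (B.γ t) - inner ℝ (B.feat t (a t ω) ω) (B.γ t)

/-- The noise of a round does not depend on the action, so it cancels in the reward gap. -/
lemma rewardGap_eq (B : Bandit Ω 𝒳 p K) (a aStar : ℤ → Ω → Fin K) (T : ℕ) (ω : Ω) :
    B.rewardGap a aStar T ω = ∑ n ∈ Finset.range T, B.instantRegret a aStar (n + 1) ω := by
  rw [rewardGap, sum_Icc_one_eq_sum_range]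
  refine Finset.sum_congr rfl fun i _ => ?_
  simp only [reward, instantRegret]
  ring

lemma measurable_history_feat (B : Bandit Ω 𝒳 p K) (a : ℤ → Ω → Fin K) {s t τ : ℤ}
    (hs : s ≤ τ) (ht : τ ≤ t) :
    Measurable[B.history a s t] fun ω => B.feat τ (a τ ω) ω := by
  rw [measurable_iff_comap_le]
  rcases ht.eq_or_lt with rfl | ht
  · exact le_sup_right
  · exact (le_sup_left.trans (le_iSup₂_of_le τ (Finset.mem_Ico.mpr ⟨hs, ht⟩) le_rfl)).trans
      le_sup_left

lemma measurable_history_reward (B : Bandit Ω 𝒳 p K) (a : ℤ → Ω → Fin K) {s t τ : ℤ}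
    (hs : s ≤ τ) (ht : τ < t) :
    Measurable[B.history a s t] fun ω => B.reward τ (a τ ω) ω := by
  rw [measurable_iff_comap_le]
  exact (le_sup_right.trans (le_iSup₂_of_le τ (Finset.mem_Ico.mpr ⟨hs, ht⟩) le_rfl)).trans
    le_sup_left

lemma measurable_history_noise (B : Bandit Ω 𝒳 p K) (a : ℤ → Ω → Fin K) {s t τ : ℤ}
    (hs : s ≤ τ) (ht : τ < t) : Measurable[B.history a s t] (B.ε τ) := by
  have h1 := B.measurable_history_reward a hs ht
  have h2 := B.measurable_history_feat a hs ht.le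
  have h3 : Measurable fun x : Vec p => inner ℝ x (B.γ τ) := by fun_prop
  have h : B.ε τ = fun ω => B.reward τ (a τ ω) ω - inner ℝ (B.feat τ (a τ ω) ω) (B.γ τ) := by
    funext ω; simp [reward]
  rw [h]
  exact h1.sub (h3.comp h2)

end Bandit

variable [MeasurableSpace Ω] [MeasurableSpace 𝒳] {μ : Measure Ω} {B : Bandit Ω 𝒳 p K}
  {a aStar : ℤ → Ω → Fin K} {𝒯 : Set ℤ} {T₀ T : ℕ} {σ L M lam : ℝ}
  {Sinv Sres : Submodule ℝ (Vec p)}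

lemma natCast_add_one_mem_Icc {n T : ℕ} (hn : n < T) : (n : ℤ) + 1 ∈ Finset.Icc (1 : ℤ) T :=
  Finset.mem_Icc.mpr ⟨by lia, by lia⟩

namespace IsHybridSetting

lemma measurable_feat (h : IsHybridSetting μ B a 𝒯 T₀ T σ L M Sinv Sres) {t : ℤ} (ht : t ∈ 𝒯)
    (b : Fin K) : Measurable (B.feat t b) :=
  (h.measurable_φ b).comp (h.measurable_X t ht)

lemma measurable_chosen_feat (h : IsHybridSetting μ B a 𝒯 T₀ T σ L M Sinv Sres) {t : ℤ}
    (ht : t ∈ 𝒯) : Measurable fun ω => B.feat t (a t ω) ω :=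
  measurable_apply_choice (h.measurable_a t ht) (h.measurable_feat ht)

lemma measurable_chosen_reward (h : IsHybridSetting μ B a 𝒯 T₀ T σ L M Sinv Sres) {t : ℤ}
    (ht : t ∈ 𝒯) : Measurable fun ω => B.reward t (a t ω) ω := by
  have h1 := h.measurable_chosen_feat ht
  have h2 := h.measurable_ε t ht
  unfold Bandit.reward
  fun_prop

lemma history_le (h : IsHybridSetting μ B a 𝒯 T₀ T σ L M Sinv Sres) {n : ℕ} (hn : n < T) :
    B.history a 1 (n + 1) ≤ ‹MeasurableSpace Ω› := by
  refine sup_le (iSup₂_le fun τ hτ => sup_le ?_ ?_) ?_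
  · exact (h.measurable_chosen_feat (h.online_mem τ (by
      simp only [Finset.mem_Ico, Finset.mem_Icc] at *; lia))).comap_le
  · exact (h.measurable_chosen_reward (h.online_mem τ (by
      simp only [Finset.mem_Ico, Finset.mem_Icc] at *; lia))).comap_le
  · exact (h.measurable_chosen_feat (h.online_mem _ (natCast_add_one_mem_Icc hn))).comap_le

/-- The policy `aStar` need not be measurable, but the reward it attains is a finite maximum of
measurable functions. -/
lemma measurable_instantRegret (h : IsHybridSetting μ B a 𝒯 T₀ T σ L M Sinv Sres)
    (hopt : B.IsOptimalPolicy aStar T) {n : ℕ} (hn : n < T) :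
    Measurable (B.instantRegret a aStar (n + 1)) := by
  have ht := natCast_add_one_mem_Icc hn
  have hfeat := fun b => h.measurable_feat (h.online_mem _ ht) b
  rcases isEmpty_or_nonempty Ω with hΩ | ⟨⟨ω₀⟩⟩
  · exact measurable_of_empty _
  have hne : (Finset.univ : Finset (Fin K)).Nonempty := ⟨a 0 ω₀, Finset.mem_univ _⟩
  have heq : (fun ω => inner ℝ (B.feat (n + 1) (aStar (n + 1) ω) ω) (B.γ (n + 1))) =
      Finset.univ.sup' hne fun b ω => inner ℝ (B.feat (n + 1) b ω) (B.γ (n + 1)) := by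
    funext ω
    rw [Finset.sup'_apply]
    refine le_antisymm (Finset.le_sup' (fun b => inner ℝ (B.feat (n + 1) b ω) (B.γ (n + 1)))
      (Finset.mem_univ _)) (Finset.sup'_le _ _ fun b _ => hopt _ ht ω b)
  refine Measurable.sub ?_ ?_
  · rw [heq]
    refine Finset.measurable_sup' hne fun b _ => ?_
    have := hfeat b
    fun_prop
  · have := h.measurable_chosen_feat (h.online_mem _ ht)
    fun_prop

lemma ae_norm_feat_le (h : IsHybridSetting μ B a 𝒯 T₀ T σ L M Sinv Sres) :
    ∀ᵐ ω ∂μ, ∀ n < T, ∀ b : Fin K, ‖B.feat (n + 1) b ω‖ ≤ L := by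
  have := (Filter.eventually_all_finset (Finset.range T)).mpr fun n hn =>
    Filter.eventually_all.mpr fun b => h.feat_bound _
      (h.online_mem _ (natCast_add_one_mem_Icc (Finset.mem_range.mp hn))) b
  simpa using this

lemma abs_instantRegret_le (h : IsHybridSetting μ B a 𝒯 T₀ T σ L M Sinv Sres) {n : ℕ}
    (hn : n < T) {ω : Ω} (hω : ∀ b : Fin K, ‖B.feat (n + 1) b ω‖ ≤ L) :
    |B.instantRegret a aStar (n + 1) ω| ≤ 2 * (L * M) := by
  have hγ := h.param_bound _ (h.online_mem _ (natCast_add_one_mem_Icc hn))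
  have hinner : ∀ b, |inner ℝ (B.feat (n + 1) b ω) (B.γ (n + 1))| ≤ L * M := fun b =>
    (abs_real_inner_le_norm _ _).trans
      (mul_le_mul (hω b) hγ (norm_nonneg _) ((norm_nonneg _).trans (hω b)))
  refine (abs_sub _ _).trans ?_
  linarith [hinner (aStar (n + 1) ω), hinner (a (n + 1) ω)]

lemma integrable_instantRegret [IsProbabilityMeasure μ]
    (h : IsHybridSetting μ B a 𝒯 T₀ T σ L M Sinv Sres)
    (hopt : B.IsOptimalPolicy aStar T) {n : ℕ} (hn : n < T) :
    Integrable (B.instantRegret a aStar (n + 1)) μ :=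
  Integrable.of_bound (h.measurable_instantRegret hopt hn).aestronglyMeasurable (2 * (L * M))
    (h.ae_norm_feat_le.mono fun _ hω => h.abs_instantRegret_le hn (hω n hn))

/-- The residual component of the online parameter in the coordinates given by `U`. -/
lemma exists_residual_coordinates (h : IsHybridSetting μ B a 𝒯 T₀ T σ L M Sinv Sres)
    {U : Matrix (Fin p) (Fin q) ℝ} (hU : IsOrthonormalBasisMatrix U Sres) {β : Vec p}
    (hβ : IsInvariantComponent B 𝒯 Sinv Sres β) (hT : 0 < T) :
    ∃ d : Fin q → ℝ, WithLp.toLp 2 (U *ᵥ d) ∈ Sres ∧ √(d ⬝ᵥ d) ≤ M ∧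
      ∀ n < T, B.γ (n + 1) = β + WithLp.toLp 2 (U *ᵥ d) := by
  have h0 := natCast_add_one_mem_Icc hT
  obtain ⟨δ, hδ, hγ⟩ := hβ.2 _ (h.online_mem _ h0)
  obtain ⟨d, rfl⟩ := hU.exists_mulVec_eq hδ
  refine ⟨d, hδ, ?_, fun n hn => ?_⟩
  · rw [← hU.norm_toLp_mulVec]
    refine le_trans ?_ (h.param_bound _ (h.online_mem _ h0))
    have hβ' := hβ.1
    rw [h.isd.orth] at hβ'
    have hpyth := norm_add_sq_eq_norm_sq_add_norm_sq_real
      (Submodule.inner_left_of_mem_orthogonal hδ hβ')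
    rw [hγ]
    refine abs_le_of_sq_le_sq' ?_ (norm_nonneg _) |>.2
    nlinarith [norm_nonneg β]
  · rw [← hγ]
    exact h.param_const _ (natCast_add_one_mem_Icc hn) _ h0

end IsHybridSetting

/-! ### The good event and the regret bound -/

/-- The event that the self-normalized tail bound fails after `n` rounds. -/
def badEvent (B : Bandit Ω 𝒳 p K) (a : ℤ → Ω → Fin K) (U : Matrix (Fin p) (Fin q) ℝ)
    (σ lam η : ℝ) (n : ℕ) : Set Ω :=
  {ω | σ ^ 2 * (2 * Real.log (1 / η) +
      Real.log ((gram lam (fun i => B.resFeat a U i ω) n).det / lam ^ q)) <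
    (∑ i ∈ Finset.range n, B.ε (i + 1) ω • B.resFeat a U i ω) ⬝ᵥ
      ((gram lam (fun i => B.resFeat a U i ω) n)⁻¹ *ᵥ
        (∑ i ∈ Finset.range n, B.ε (i + 1) ω • B.resFeat a U i ω))}

lemma IsHybridSetting.measure_badEvent_le [IsProbabilityMeasure μ]
    (h : IsHybridSetting μ B a 𝒯 T₀ T σ L M Sinv Sres) (U : Matrix (Fin p) (Fin q) ℝ)
    (hσ : 0 ≤ σ) (hlam : 0 < lam) {η : ℝ} (hη : 0 < η) {n : ℕ} (hn : n < T) :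
    μ (badEvent B a U σ lam η n) ≤ ENNReal.ofReal η := by
  have hcoord : Measurable fun x : Vec p => Uᵀ *ᵥ WithLp.ofLp x :=
    Continuous.measurable (by fun_prop)
  refine measure_selfNormalized_gt_le (F := fun i => B.history a 1 (i + 1))
    (e := fun i => B.ε (i + 1)) (z := B.resFeat a U) hσ hlam hη ?_ ?_ ?_ ?_ ?_
  · exact fun i hi => h.history_le (hi.trans hn)
  · exact fun i hi => h.measurable_ε _ (h.online_mem _ (natCast_add_one_mem_Icc (hi.trans hn)))
  · exact fun i _ j hj => B.measurable_history_noise a (by lia) (by lia)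
  · exact fun i _ j hj => hcoord.comp (B.measurable_history_feat a (by lia) (by lia))
  · exact fun i hi => h.noise_online _ (natCast_add_one_mem_Icc (hi.trans hn))

/-- Outside the bad event, the regret of a round is controlled by the width of the confidence
ellipsoid in the direction of the chosen feature. -/
lemma IsHybridSetting.instantRegret_le_of_notMem_badEvent
    (h : IsHybridSetting μ B a 𝒯 T₀ T σ L M Sinv Sres) {U : Matrix (Fin p) (Fin q) ℝ}
    (hU : IsOrthonormalBasisMatrix U Sres) {β : Vec p}
    (hβ : IsInvariantComponent B 𝒯 Sinv Sres β) {η : ℝ}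
    (halg : B.IsOracleISDLinUCB a T σ L M lam η U Sres β)
    (hσ : 0 ≤ σ) (hlam : 0 < lam) (hq : 0 < q) {n : ℕ} (hn : n < T) {ω : Ω}
    (hω : ∀ n < T, ∀ b : Fin K, ‖B.feat (n + 1) b ω‖ ≤ L)
    (hgood : ω ∉ badEvent B a U σ lam η n) :
    B.instantRegret a aStar (n + 1) ω ≤ 2 * √(radius σ L M lam η q (n + 1)) *
        √(B.resFeat a U n ω ⬝ᵥ ((gram lam (fun i => B.resFeat a U i ω) n)⁻¹ *ᵥ
          B.resFeat a U n ω)) := by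
  obtain ⟨d, hdS, hd, hγ⟩ := h.exists_residual_coordinates hU hβ (by lia : 0 < T)
  obtain ⟨ucb, hucb, hmax⟩ := halg _ (natCast_add_one_mem_Icc hn) ω
  rw [Bandit.instantRegret, hγ n hn]
  refine B.inner_feat_sub_le hlam hU ⟨hdS, ?_⟩ hucb hmax _
  rw [B.resEstimate_eq a lam hU.1 (fun i hi => hγ i (hi.trans hn)), ← WithLp.toLp_sub,
    ← Matrix.mulVec_sub, weightedSqNorm_toLp_mulVec, add_sub_cancel_right,
    B.transpose_mul_covMatrix_mul a lam hU.1]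
  refine ridge_error_le_radius hq hlam hσ (fun i hi => ?_) hd (not_lt.mp hgood) rfl
  refine (hU.dotProduct_transpose_mulVec_self_le _).trans ?_
  exact pow_le_pow_left₀ (norm_nonneg _) (hω i (hi.trans hn) _) 2

/-- A bound for the regret on the good event, and the expected contribution `2 L M` of the bad
events, each of which has probability at most `1 / T`. -/
lemma IsHybridSetting.regret_le [IsProbabilityMeasure μ]
    (h : IsHybridSetting μ B a 𝒯 T₀ T σ L M Sinv Sres) {U : Matrix (Fin p) (Fin q) ℝ}
    (hU : IsOrthonormalBasisMatrix U Sres) {β : Vec p}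
    (hβ : IsInvariantComponent B 𝒯 Sinv Sres β)
    (halg : B.IsOracleISDLinUCB a T σ L M lam (1 / (T : ℝ)) U Sres β)
    (hopt : B.IsOptimalPolicy aStar T)
    (hσ : 0 ≤ σ) (hlam : 0 < lam) (hq : 0 < q) (hT : 0 < T) :
    Integrable (B.rewardGap a aStar T) μ ∧
      B.regret μ a aStar T ≤
        2 * (σ * √(2 * Real.log T + q * Real.log (1 + T * L ^ 2 / (lam * q))) + √lam * M) *
          √(T * ((1 + L ^ 2 / lam) * (q * Real.log (1 + T * L ^ 2 / (lam * q))))) +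
        2 * (L * M) := by
  have hT' : (0 : ℝ) < T := by exact_mod_cast hT
  have hgap : B.rewardGap a aStar T =
      fun ω => ∑ n ∈ Finset.range T, B.instantRegret a aStar (n + 1) ω :=
    funext fun ω => B.rewardGap_eq a aStar T ω
  have hint : Integrable (B.rewardGap a aStar T) μ := by
    rw [hgap]
    exact integrable_finsetSum _ fun n hn =>
      h.integrable_instantRegret hopt (Finset.mem_range.mp hn)
  refine ⟨hint, ?_⟩
  obtain ⟨d, -, hd, -⟩ := h.exists_residual_coordinates hU hβ hT
  have hM : 0 ≤ M := (Real.sqrt_nonneg _).trans hd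
  have hL : 0 ≤ L := by
    obtain ⟨ω, hω⟩ := h.ae_norm_feat_le.exists
    exact (norm_nonneg _).trans (hω 0 hT (a 0 ω))
  set R := σ * √(2 * Real.log T + q * Real.log (1 + T * L ^ 2 / (lam * q))) + √lam * M with hR
  set W := (1 + L ^ 2 / lam) * (q * Real.log (1 + T * L ^ 2 / (lam * q))) with hW
  have hR0 : 0 ≤ R := by positivity
  have hradius : ∀ n < T, √(radius σ L M lam (1 / (T : ℝ)) q (n + 1)) ≤ R := by
    intro n hn
    have hn' : ((n : ℝ) + 1) ≤ T := by exact_mod_cast hn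
    rw [radius, Real.sqrt_sq (by positivity), hR, one_div_one_div]
    push_cast
    gcongr
  -- a bad event need not be measurable; its measurable hull has the same measure
  set bad : ℕ → Set Ω := fun n => toMeasurable μ (badEvent B a U σ lam (1 / (T : ℝ)) n) with hbad
  have hbadm : ∀ n, MeasurableSet (bad n) := fun n => measurableSet_toMeasurable _ _
  have hbadle : ∀ n ∈ Finset.range T, μ.real (bad n) ≤ 1 / T := by
    intro n hn
    refine ENNReal.toReal_le_of_le_ofReal (by positivity) ?_
    rw [hbad, measure_toMeasurable]
    exact h.measure_badEvent_le U hσ hlam (by positivity) (Finset.mem_range.mp hn)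
  have hpoint : ∀ᵐ ω ∂μ, B.rewardGap a aStar T ω ≤ 2 * R * √(T * W) +
      ∑ n ∈ Finset.range T, (bad n).indicator (fun _ => 2 * (L * M)) ω := by
    filter_upwards [h.ae_norm_feat_le] with ω hω
    set x : ℕ → ℝ := fun n => B.resFeat a U n ω ⬝ᵥ
      ((gram lam (fun i => B.resFeat a U i ω) n)⁻¹ *ᵥ B.resFeat a U n ω) with hx
    have hx0 : ∀ n, 0 ≤ x n := fun n =>
      dotProduct_mulVec_nonneg' (gram_posDef hlam _ n).inv.posSemidef _
    have hround : ∀ n ∈ Finset.range T, B.instantRegret a aStar (n + 1) ω ≤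
        2 * R * √(x n) + (bad n).indicator (fun _ => 2 * (L * M)) ω := by
      intro n hn
      have hn := Finset.mem_range.mp hn
      by_cases hmem : ω ∈ bad n
      · rw [Set.indicator_of_mem hmem]
        have := (le_abs_self _).trans (h.abs_instantRegret_le (aStar := aStar) hn (hω n hn))
        have : 0 ≤ 2 * R * √(x n) := by positivity
        linarith
      · rw [Set.indicator_of_notMem hmem, add_zero]
        refine (h.instantRegret_le_of_notMem_badEvent hU hβ halg hσ hlam hq hn hω
          fun hb => hmem (subset_toMeasurable _ _ hb)).trans ?_
        have := hradius n hn
        gcongr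
    have hsqrt : ∑ n ∈ Finset.range T, √(x n) ≤ √(T * W) := by
      refine Real.le_sqrt_of_sq_le (sq_sum_le_card_mul_sum_sq.trans ?_)
      rw [Finset.card_range]
      gcongr
      rw [Finset.sum_congr rfl fun n _ => Real.sq_sqrt (hx0 n)]
      refine sum_dotProduct_gram_inv_le hq hlam fun i hi => ?_
      refine (hU.dotProduct_transpose_mulVec_self_le _).trans ?_
      exact pow_le_pow_left₀ (norm_nonneg _) (hω i hi _) 2
    rw [B.rewardGap_eq]
    refine (Finset.sum_le_sum hround).trans ?_
    rw [Finset.sum_add_distrib, ← Finset.mul_sum]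
    gcongr
  have hindint : ∀ n, Integrable ((bad n).indicator fun _ : Ω => 2 * (L * M)) μ := fun n =>
    (integrable_const _).indicator (hbadm n)
  calc B.regret μ a aStar T
      ≤ ∫ ω, (2 * R * √(T * W) +
          ∑ n ∈ Finset.range T, (bad n).indicator (fun _ => 2 * (L * M)) ω) ∂μ :=
        integral_mono_ae hint ((integrable_const _).add
          (integrable_finsetSum _ fun n _ => hindint n)) hpoint
    _ = 2 * R * √(T * W) + ∑ n ∈ Finset.range T, μ.real (bad n) * (2 * (L * M)) := by
        rw [integral_add (integrable_const _) (integrable_finsetSum _ fun n _ => hindint n),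
          integral_finsetSum _ fun n _ => hindint n]
        simp [integral_indicator_const, hbadm]
    _ ≤ 2 * R * √(T * W) + ∑ n ∈ Finset.range T, 1 / T * (2 * (L * M)) := by
        gcongr with n hn
        exact hbadle n hn
    _ = 2 * R * √(T * W) + 2 * (L * M) := by
        rw [Finset.sum_const, Finset.card_range, nsmul_eq_mul]
        field_simp

end Setting

/-- The bound of the regret in terms of `q √T log T`, once `log T ≥ 1`. -/
lemma regret_bound_le {σ L M lam : ℝ} (hσ : 0 ≤ σ) (hlam : 0 < lam) {q T : ℕ} (hq : 0 < q)
    (hT : 3 ≤ T) :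
    2 * (σ * √(2 * Real.log T + q * Real.log (1 + T * L ^ 2 / (lam * q))) + √lam * M) *
        √(T * ((1 + L ^ 2 / lam) * (q * Real.log (1 + T * L ^ 2 / (lam * q))))) + 2 * (L * M) ≤
      (2 * (σ * √(3 * (1 + Real.log (1 + L ^ 2 / lam))) + √lam * |M|) *
        √((1 + L ^ 2 / lam) * (1 + Real.log (1 + L ^ 2 / lam))) + 2 * |L * M| + 1) *
        (q * √T) * Real.log T ^ 1 := by
  have hq1 : (1 : ℝ) ≤ q := by exact_mod_cast hq
  have hT3 : (3 : ℝ) ≤ T := by exact_mod_cast hT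
  have hlog : 1 ≤ Real.log T := by
    rw [Real.le_log_iff_exp_le (by linarith)]
    linarith [Real.exp_one_lt_d9]
  have hA : 0 ≤ L ^ 2 / lam := by positivity
  have hB0 : 0 ≤ Real.log (1 + L ^ 2 / lam) := Real.log_nonneg (by linarith)
  set ℓ := Real.log T with hℓ
  set G := 1 + Real.log (1 + L ^ 2 / lam) with hG
  have hG1 : 1 ≤ G := by linarith
  have hGℓ : Real.log (1 + T * L ^ 2 / (lam * q)) ≤ G * ℓ := by
    calc Real.log (1 + T * L ^ 2 / (lam * q)) ≤ Real.log (T * (1 + L ^ 2 / lam)) := by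
          refine Real.log_le_log (by positivity) ?_
          have : T * L ^ 2 / (lam * q) ≤ T * (L ^ 2 / lam) := by
            rw [mul_div_assoc]
            gcongr
            exact le_mul_of_one_le_right hlam.le hq1
          linarith
      _ = ℓ + Real.log (1 + L ^ 2 / lam) := Real.log_mul (by positivity) (by positivity)
      _ ≤ ℓ + Real.log (1 + L ^ 2 / lam) * ℓ := by
          gcongr; exact le_mul_of_one_le_right hB0 hlog
      _ = G * ℓ := by ring
  have hqℓ : 1 ≤ q * ℓ := one_le_mul_of_one_le_of_one_le hq1 hlog
  have h1 : √(2 * ℓ + q * Real.log (1 + T * L ^ 2 / (lam * q))) ≤ √(3 * G) * √(q * ℓ) := by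
    rw [← Real.sqrt_mul (by positivity)]
    refine Real.sqrt_le_sqrt ?_
    have h2 : ℓ ≤ q * (G * ℓ) := by
      rw [← mul_assoc]
      exact le_mul_of_one_le_left (by linarith) (one_le_mul_of_one_le_of_one_le hq1 hG1)
    have h3 : q * Real.log (1 + T * L ^ 2 / (lam * q)) ≤ q * (G * ℓ) := by gcongr
    linarith
  have h2 : √lam * M ≤ √lam * |M| * √(q * ℓ) := by
    calc √lam * M ≤ √lam * |M| := by gcongr; exact le_abs_self M
      _ ≤ √lam * |M| * √(q * ℓ) :=
        le_mul_of_one_le_right (by positivity) (Real.one_le_sqrt.mpr hqℓ)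
  have h3 : √(T * ((1 + L ^ 2 / lam) * (q * Real.log (1 + T * L ^ 2 / (lam * q))))) ≤
      √T * (√((1 + L ^ 2 / lam) * G) * √(q * ℓ)) := by
    rw [← Real.sqrt_mul (by positivity), ← Real.sqrt_mul (by positivity)]
    refine Real.sqrt_le_sqrt ?_
    calc T * ((1 + L ^ 2 / lam) * (q * Real.log (1 + T * L ^ 2 / (lam * q))))
        ≤ T * ((1 + L ^ 2 / lam) * (q * (G * ℓ))) := by gcongr
      _ = _ := by ring
  have hsq : √(q * ℓ) * √(q * ℓ) = q * ℓ := Real.mul_self_sqrt (by linarith)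
  have hsT : 1 ≤ √(T : ℝ) := Real.one_le_sqrt.mpr (by linarith)
  have h4 : 1 ≤ q * √T * ℓ := by
    have := one_le_mul_of_one_le_of_one_le hqℓ hsT
    linarith
  have h5 : L * M ≤ |L * M| * (q * √T * ℓ) :=
    (le_abs_self _).trans (le_mul_of_one_le_right (abs_nonneg _) h4)
  have h6 : 2 * (σ * √(2 * ℓ + q * Real.log (1 + T * L ^ 2 / (lam * q))) + √lam * M) *
        √(T * ((1 + L ^ 2 / lam) * (q * Real.log (1 + T * L ^ 2 / (lam * q))))) ≤
      2 * (σ * (√(3 * G) * √(q * ℓ)) + √lam * |M| * √(q * ℓ)) *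
        (√T * (√((1 + L ^ 2 / lam) * G) * √(q * ℓ))) := by
    gcongr
  calc _ ≤ 2 * (σ * (√(3 * G) * √(q * ℓ)) + √lam * |M| * √(q * ℓ)) *
        (√T * (√((1 + L ^ 2 / lam) * G) * √(q * ℓ))) + 2 * (|L * M| * (q * √T * ℓ)) +
          q * √T * ℓ := by linarith
    _ = 2 * (σ * √(3 * G) + √lam * |M|) * √((1 + L ^ 2 / lam) * G) * √T *
          (√(q * ℓ) * √(q * ℓ)) + 2 * (|L * M| * (q * √T * ℓ)) + q * √T * ℓ := by ring
    _ = _ := by rw [hsq]; ring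

end ISDBandit

theorem theorem1 (σ L M lam : ℝ) (hσ : 0 ≤ σ) (hlam : 0 < lam) :
    ∃ c : ℝ, 0 < c ∧ ∃ k N : ℕ,
      ∀ (Ω : Type u) [MeasurableSpace Ω] (μ : Measure Ω) [IsProbabilityMeasure μ]
        (𝒳 : Type v) [MeasurableSpace 𝒳] (p q K T₀ T : ℕ) (𝒯 : Set ℤ)
        (B : ISDBandit.Bandit Ω 𝒳 p K) (a aStar : ℤ → Ω → Fin K)
        (Sinv Sres : Submodule ℝ (ISDBandit.Vec p)) (U : Matrix (Fin p) (Fin q) ℝ)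
        (β : ISDBandit.Vec p),
        N ≤ T →
        ISDBandit.IsHybridSetting μ B a 𝒯 T₀ T σ L M Sinv Sres →
        ISDBandit.IsOrthonormalBasisMatrix U Sres →
        ISDBandit.IsInvariantComponent B 𝒯 Sinv Sres β →
        B.IsOracleISDLinUCB a T σ L M lam (1 / (T : ℝ)) U Sres β →
        B.IsOptimalPolicy aStar T →
        Integrable (B.rewardGap a aStar T) μ ∧
          B.regret μ a aStar T ≤
            c * ((Module.finrank ℝ Sres : ℝ) * √(T : ℝ)) * Real.log (T : ℝ) ^ k := by
  have hlog : 0 ≤ Real.log (1 + L ^ 2 / lam) :=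
    Real.log_nonneg (by linarith [show 0 ≤ L ^ 2 / lam by positivity])
  refine ⟨2 * (σ * √(3 * (1 + Real.log (1 + L ^ 2 / lam))) + √lam * |M|) *
    √((1 + L ^ 2 / lam) * (1 + Real.log (1 + L ^ 2 / lam))) + 2 * |L * M| + 1, by positivity,
    1, 3, ?_⟩
  intro Ω _ μ _ 𝒳 _ p q K T₀ T 𝒯 B a aStar Sinv Sres U β hT h hU hβ halg hopt
  have hq : 0 < q := by
    have h1 := Sres.finrank_add_finrank_orthogonal
    rw [← h.isd.orth, finrank_euclideanSpace_fin, hU.finrank_eq] at h1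
    have h2 := h.isd.nondegenerate
    lia
  obtain ⟨hint, hreg⟩ := h.regret_le hU hβ halg hopt hσ hlam hq (by lia)
  rw [hU.finrank_eq]
  exact ⟨hint, hreg.trans (ISDBandit.regret_bound_le hσ hlam hq hT)⟩
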